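/- Let $\mathsf N\ge 0$ be an integer, $q\in\mathbb C$ with $q\ne 0$ and $q^2\neq 1$, and let $\eta_1,\dots,\eta_{\mathsf N}\in\mathbb C\setminus\{0\}$ satisfy $\eta_a\neq \pm q^{j}\eta_b$ for all $j\in\{-1,0,1\}$ and $1\le a<b\le \mathsf N$. On the chain $\mathcal R_{\mathsf N}=\bigotimes_{n=1}^{\mathsf N}\mathbb C^2$ let $\sigma_n^{z}$, $\sigma_n^{\pm}$ be the Pauli matrices $\sigma^z=\begin{pmatrix}1&0\\0&-1\end{pmatrix}$, $\sigma^+=\begin{pmatrix}0&1\\0&0\end{pmatrix}$, $\sigma^-=\begin{pmatrix}0&0\\1&0\end{pmatrix}$ acting at site $n$. Put $x_\pm(\lambda)=\tfrac12\bigl(\lambda q-(q\lambda)^{-1}\pm(\lambda-\lambda^{-1})\bigr)$ and, for $\lambda\neq 0$, $$\mathsf L_{0n}(\lambda)=\begin{pmatrix}x_+(\lambda)+x_-(\lambda)\sigma_n^z&(q-q^{-1})\sigma_n^-\\(q-q^{-1})\sigma_n^+&x_+(\lambda)-x_-(\lambda)\sigma_n^z\end{pmatrix},\qquad \begin{pmatrix}\mathsf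 A(\lambda)&\mathsf B(\lambda)\\\mathsf C(\lambda)&\mathsf D(\lambda)\end{pmatrix}=\mathsf L_{0\mathsf N}(\lambda/\eta_{\mathsf N})\cdots\mathsf L_{01}(\lambda/\eta_1).$$ These operators act on $\mathcal R_{\mathsf N}$ and, from the right, on the dual space $\mathcal L_{\mathsf N}$ of covectors. Let $|0\rangle$ be the tensor product of the vectors $\binom10$, let $\langle 0|$ be the corresponding dual basis covector, and put $$a(\lambda)=-\prod_{n=1}^{\mathsf N}\Bigl(\frac{\lambda q}{\eta_n}-\frac{\eta_n}{\lambda q}\Bigr),\quad d(\lambda)=\prod_{n=1}^{\mathsf N}\Bigl(\frac{\lambda}{\eta_n}-\frac{\eta_n}{\lambda}\Bigr),\quad d_{\mathbf h}(\lambda)=\prod_{n=1}^{\mathsf N}\Bigl(\frac{\lambda q^{h_n}}{\eta_n}-\frac{\eta_n}{\lambda q^{h_n}}\Bigr),\quad \mathrm n=\prod_{1\le b<a\le\mathsf N}\Bigl(\frac{\eta_a}{\eta_b}-\frac{\eta_b}{\eta_a}\Bigr)^{1/2},$$ with any fixed choice of the square roots. For $\mathbf h=(h_1,\dots,h_{\mathsf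 N})\in\{0,1\}^{\mathsf N}$ define $$\langle\mathbf h|=\frac1{\mathrm n}\langle 0|\prod_{n=1}^{\mathsf N}\Bigl(\frac{\mathsf C(\eta_n)}{d(\eta_n/q)}\Bigr)^{h_n},\qquad |\mathbf h\rangle=\frac1{\mathrm n}\prod_{n=1}^{\mathsf N}\Bigl(\frac{\mathsf B(\eta_n)}{a(\eta_n)}\Bigr)^{h_n}|0\rangle .$$ The operators $\mathsf C(\lambda)$ commute with each other, and so do the $\mathsf B(\lambda)$, so the order of the factors is immaterial. Let $\mathrm T_a^{\pm}$ replace $h_a$ by $h_a\pm1$; a term in which $h_a\pm1\notin\{0,1\}$ is read as zero (its coefficient $d(\eta_a)=0$ or $a(\eta_a/q)=0$ vanishes). Put $$\ell_{a,\mathbf h}(\lambda)=\prod_{b\neq a}\frac{\lambda q^{h_b}/\eta_b-\eta_b/(q^{h_b}\lambda)}{\eta_aq^{h_b-h_a}/\eta_b-\eta_b/(q^{h_b-h_a}\eta_a)} .$$ **I) Left.** The covectors $\langle\mathbf h|$, $\mathbf h\in\{0,1\}^{\mathsf N}$, form a basis of $\mathcal L_{\mathsf N}$, and for all $\lambda\ne0$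 $$\langle\mathbf h|\mathsf D(\lambda)=d_{\mathbf h}(\lambda)\langle\mathbf h|,\quad \langle\mathbf h|\mathsf C(\lambda)=\sum_{a=1}^{\mathsf N}\ell_{a,\mathbf h}(\lambda)\,d(\eta_aq^{h_a-1})\,\langle\mathbf h|\mathrm T_a^{+},\quad \langle\mathbf h|\mathsf B(\lambda)=\sum_{a=1}^{\mathsf N}\ell_{a,\mathbf h}(\lambda)\,a(\eta_aq^{h_a-1})\,\langle\mathbf h|\mathrm T_a^{-}.$$ **II) Right.** The vectors $|\mathbf h\rangle$, $\mathbf h\in\{0,1\}^{\mathsf N}$, form a basis of $\mathcal R_{\mathsf N}$, and for all $\lambda\ne0$ $$\mathsf D(\lambda)|\mathbf h\rangle=d_{\mathbf h}(\lambda)|\mathbf h\rangle,\quad \mathsf C(\lambda)|\mathbf h\rangle=\sum_{a=1}^{\mathsf N}\ell_{a,\mathbf h}(\lambda)\,d(\eta_aq^{-h_a})\,\mathrm T_a^{-}|\mathbf h\rangle,\quad \mathsf B(\lambda)|\mathbf h\rangle=\sum_{a=1}^{\mathsf N}\ell_{a,\mathbf h}(\lambda)\,a(\eta_aq^{-h_a})\,\mathrm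 T_a^{+}|\mathbf h\rangle.$$ In both representations $\mathsf A(\lambda)$ is uniquely determined by the quantum determinant relation $$\mathsf A(\lambda)\mathsf D(\lambda/q)-\mathsf B(\lambda)\mathsf C(\lambda/q)=-a(\lambda)\,d(\lambda/q)\cdot\mathbb I\qquad(\lambda\neq0):$$ the relation holds; for each $\lambda\ne0$ with $d_{\mathbf h}(\lambda/q)\neq0$ for all $\mathbf h$, the operator $\mathsf A(\lambda)$ is the only one that satisfies it; and $\lambda\mapsto\mathsf A(\lambda)$ is the only continuous operator-valued function on $\mathbb C\setminus\{0\}$ that satisfies it for all $\lambda\neq0$. -/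

import Mathlib

open scoped Matrix

namespace XXZ

/-- Labels of the standard spin basis of a chain of `N` sites: `0` is spin up
(eigenvalue `1` of `σᶻ`) and `1` is spin down (eigenvalue `-1` of `σᶻ`). The same type
indexes the separate variables `h ∈ {0,1}^N`. -/
abbrev Spins (N : ℕ) : Type := Fin N → Fin 2

/-- The vectors of `ℂ² ⊗ ⋯ ⊗ ℂ²` (`N` factors), in coordinates in the standard spin basis. -/
abbrev RightSpace (N : ℕ) : Type := Spins N → ℂ

/-- The covectors, i.e. the dual space, in coordinates in the dual spin basis. -/
abbrev LeftSpace (N : ℕ) : Type := Spins N → ℂ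

/-- Operators on the chain, as matrices in the standard spin basis. They act on vectors by
`*ᵥ` and on covectors by `ᵥ*`. -/
abbrev Op (N : ℕ) : Type := Matrix (Spins N) (Spins N) ℂ

def sigmaZ : Matrix (Fin 2) (Fin 2) ℂ := !![1, 0; 0, -1]
def sigmaPlus : Matrix (Fin 2) (Fin 2) ℂ := !![0, 1; 0, 0]
def sigmaMinus : Matrix (Fin 2) (Fin 2) ℂ := !![0, 0; 1, 0]

/-- The operator `1 ⊗ ⋯ ⊗ X ⊗ ⋯ ⊗ 1` with `X` at site `n`. -/
def siteOp {N : ℕ} (n : Fin N) (X : Matrix (Fin 2) (Fin 2) ℂ) : Op N :=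
  fun s t => if ∀ m, m ≠ n → s m = t m then X (s n) (t n) else 0

noncomputable section

def xPlus (q lam : ℂ) : ℂ := (lam * q - (q * lam)⁻¹ + (lam - lam⁻¹)) / 2
def xMinus (q lam : ℂ) : ℂ := (lam * q - (q * lam)⁻¹ - (lam - lam⁻¹)) / 2

/-- The Lax operator at site `n`: a `2 × 2` matrix in the auxiliary space, with entries
operators on the chain. -/
def lax {N : ℕ} (q : ℂ) (n : Fin N) (lam : ℂ) : Matrix (Fin 2) (Fin 2) (Op N) :=
  !![xPlus q lam • (1 : Op N) + xMinus q lam • siteOp n sigmaZ,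
      (q - q⁻¹) • siteOp n sigmaMinus;
     (q - q⁻¹) • siteOp n sigmaPlus,
      xPlus q lam • (1 : Op N) - xMinus q lam • siteOp n sigmaZ]

/-- The monodromy matrix `L_N(lam / η_N) ⋯ L_1(lam / η_1)`. -/
def monodromy {N : ℕ} (q : ℂ) (η : Fin N → ℂ) (lam : ℂ) : Matrix (Fin 2) (Fin 2) (Op N) :=
  (List.ofFn fun n : Fin N => lax q n (lam / η n)).reverse.prod

def opA {N : ℕ} (q : ℂ) (η : Fin N → ℂ) (lam : ℂ) : Op N := monodromy q η lam 0 0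
def opB {N : ℕ} (q : ℂ) (η : Fin N → ℂ) (lam : ℂ) : Op N := monodromy q η lam 0 1
def opC {N : ℕ} (q : ℂ) (η : Fin N → ℂ) (lam : ℂ) : Op N := monodromy q η lam 1 0
def opD {N : ℕ} (q : ℂ) (η : Fin N → ℂ) (lam : ℂ) : Op N := monodromy q η lam 1 1

def aFun {N : ℕ} (q : ℂ) (η : Fin N → ℂ) (lam : ℂ) : ℂ :=
  -∏ n, (lam * q / η n - η n / (lam * q))

def dFun {N : ℕ} (η : Fin N → ℂ) (lam : ℂ) : ℂ := ∏ n, (lam / η n - η n / lam)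

/-- The eigenvalue `d_h(lam)`. -/
def dEigen {N : ℕ} (q : ℂ) (η : Fin N → ℂ) (h : Spins N) (lam : ℂ) : ℂ :=
  ∏ n, (lam * q ^ (h n : ℕ) / η n - η n / (lam * q ^ (h n : ℕ)))

/-- The normalization `∏_{b < a} r_{ab}`, where `r_{ab}` is a square root of
`η_a / η_b - η_b / η_a`. -/
def normFactor {N : ℕ} (r : Fin N → Fin N → ℂ) : ℂ :=
  ∏ a, ∏ b ∈ Finset.univ.filter (fun b => b < a), r a b

/-- The reference state (all spins up), as a vector or as a covector. -/
def refState (N : ℕ) : Spins N → ℂ := Pi.single (fun _ => 0) 1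

/-- The covector `⟨h_1, …, h_N|`. -/
def leftState {N : ℕ} (q : ℂ) (η : Fin N → ℂ) (r : Fin N → Fin N → ℂ) (h : Spins N) :
    LeftSpace N :=
  (normFactor r)⁻¹ •
    (refState N ᵥ*
      (List.ofFn fun n : Fin N => ((dFun η (η n / q))⁻¹ • opC q η (η n)) ^ (h n : ℕ)).prod)

/-- The vector `|h_1, …, h_N⟩`. -/
def rightState {N : ℕ} (q : ℂ) (η : Fin N → ℂ) (r : Fin N → Fin N → ℂ) (h : Spins N) :
    RightSpace N :=
  (normFactor r)⁻¹ •
    ((List.ofFn fun n : Fin N => ((aFun q η (η n))⁻¹ • opB q η (η n)) ^ (h n : ℕ)).prod *ᵥ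
      refState N)

/-- `T_a^+`: replaces `h_a` by `h_a + 1`; zero if `h_a + 1` is not in `{0,1}`. -/
def shiftUp {N : ℕ} (ψ : Spins N → Spins N → ℂ) (a : Fin N) (h : Spins N) : Spins N → ℂ :=
  if h a = 0 then ψ (Function.update h a 1) else 0

/-- `T_a^-`: replaces `h_a` by `h_a - 1`; zero if `h_a - 1` is not in `{0,1}`. -/
def shiftDown {N : ℕ} (ψ : Spins N → Spins N → ℂ) (a : Fin N) (h : Spins N) : Spins N → ℂ :=
  if h a = 1 then ψ (Function.update h a 0) else 0

/-- The Lagrange interpolation coefficient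
`∏_{b ≠ a} (lam q^{h_b}/η_b - η_b/(q^{h_b} lam)) /
(η_a q^{h_b-h_a}/η_b - η_b/(q^{h_b-h_a} η_a))`. -/
def interp {N : ℕ} (q : ℂ) (η : Fin N → ℂ) (h : Spins N) (a : Fin N) (lam : ℂ) : ℂ :=
  ∏ b ∈ Finset.univ.erase a,
    (lam * q ^ (h b : ℕ) / η b - η b / (q ^ (h b : ℕ) * lam)) /
      (η a * q ^ (((h b : ℕ) : ℤ) - ((h a : ℕ) : ℤ)) / η b -
        η b / (q ^ (((h b : ℕ) : ℤ) - ((h a : ℕ) : ℤ)) * η a))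

end

end XXZ

/-!
The proof is an algebraic Bethe ansatz in which the states are labelled by the zeros of the
eigenvalues of `D`.

Each Lax operator satisfies the Yang-Baxter equation (`ell_RTT`), and operators at different
sites commute, so the monodromy matrix satisfies the `RTT` relation (`mono_RTT`). In the same way
the quantum determinant of one site (`ell_QDet`) gives that of the chain (`mono_QDet`). The
entries of the monodromy matrix are Laurent polynomials of bounded degree, even on the diagonal
and odd off it (`mono_entryLaurent`).

For covectors the raising operator is `C` and the lowering operator is `B`; for vectors it is the
other way round. After transposition the two cases obey the same relations, collected in
`SeparateStates`, and the argument is given once for both.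

* `D` is diagonal: the exchange relation of `D(lam)` with the raising operator at `η_a` has an
  unwanted term containing `D(η_a)`, which annihilates every state with `h_a = 0`
  (`SeparateStates.diag_apply`).
* The raising and lowering operators have `N` free coefficients, so they are determined by
  interpolation from the zeros `η_a q^{-h_a}` of `d_h`. At these points the raising operator acts
  by the definition of the states if `h_a = 0`. If `h_a = 1` it gives zero, because the product
  of two entries of one row of the monodromy matrix at `η_a` and `η_a / q` vanishes: this product
  factors through the antisymmetrizer of the auxiliary spaces (`mono_mul_eq_zero`). Unlike an
  argument from the spectrum of `D`, this needs no assumption on roots of unity. The lowering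
  operator acts by the quantum determinant if `h_a = 1` and gives zero if `h_a = 0`
  (`SeparateStates.lower_apply_one`, `SeparateStates.lower_apply_zero`).
* The states are nonzero, because lowering leads back to the reference state, and the zeros of the
  eigenvalues of `D` tell them apart, so they form a basis (`SeparateStates.exists_basis`).

Finally `A` is determined where `D(lam / q)` is invertible, which excludes finitely many `lam`,
and elsewhere by continuity.
-/

namespace XXZ

/-! ### Operators at one site -/

theorem siteOp_mulVec {N : ℕ} (n : Fin N) (X : Matrix (Fin 2) (Fin 2) ℂ) (v : Spins N → ℂ)
    (s : Spins N) :
    (siteOp n X *ᵥ v) s = ∑ x, X (s n) x * v (Function.update s n x) := by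
  rw [Matrix.mulVec, dotProduct]
  symm
  refine Finset.sum_of_injOn (fun x => Function.update s n x) ?_ ?_ ?_ ?_
  · intro x _ y _ h
    simpa using congrFun h n
  · simp
  · intro t _ ht
    rw [siteOp, if_neg, zero_mul]
    intro h
    refine ht ⟨t n, by simp, ?_⟩
    funext m
    by_cases hm : m = n
    · subst hm; simp
    · simp [hm, h m hm]
  · intro x _
    have : ∀ m, m ≠ n → s m = Function.update s n x m := by
      intro m hm; simp [hm]
    simp only [siteOp]
    rw [if_pos this]
    simp

theorem op_ext {N : ℕ} {X Y : Op N} (h : ∀ v, X *ᵥ v = Y *ᵥ v) : X = Y :=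
  Matrix.toLin'.injective (LinearMap.ext fun v => by simpa using h v)

/-- The embedding of the one-site operators at site `n`, as an algebra homomorphism. -/
def siteHom {N : ℕ} (n : Fin N) : Matrix (Fin 2) (Fin 2) ℂ →ₐ[ℂ] Op N :=
  AlgHom.ofLinearMap
    { toFun := siteOp n
      map_add' := by
        intro X Y; ext s t; simp only [siteOp, Matrix.add_apply]; split_ifs <;> simp
      map_smul' := by
        intro c X; ext s t; simp only [siteOp, Matrix.smul_apply]; split_ifs <;> simp }
    (by
      refine op_ext fun v => funext fun s => ?_
      simp [siteOp_mulVec, Matrix.one_apply])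
    (by
      intro X Y
      refine op_ext fun v => funext fun s => ?_
      simp only [LinearMap.coe_mk, AddHom.coe_mk]
      rw [← Matrix.mulVec_mulVec]
      simp only [siteOp_mulVec, Matrix.mul_apply, Function.update_self, Function.update_idem]
      simp only [Fin.sum_univ_two]
      ring)

theorem siteHom_apply {N : ℕ} (n : Fin N) (X : Matrix (Fin 2) (Fin 2) ℂ) :
    siteHom n X = siteOp n X := rfl

theorem siteHom_commute {N : ℕ} {n m : Fin N} (h : n ≠ m) (X Y : Matrix (Fin 2) (Fin 2) ℂ) :
    Commute (siteHom n X) (siteHom m Y) := by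
  refine op_ext fun v => funext fun s => ?_
  rw [← Matrix.mulVec_mulVec, ← Matrix.mulVec_mulVec]
  simp only [siteHom_apply, siteOp_mulVec, Function.update_of_ne h, Function.update_of_ne h.symm,
    Fin.sum_univ_two, Function.update_comm h]
  ring

/-! ### The Lax operator -/

/-- The antisymmetric bracket `x - 1/x`. -/
noncomputable def br (x : ℂ) : ℂ := x - x⁻¹

theorem br_div (x y : ℂ) : br (x / y) = x / y - y / x := by rw [br, inv_div]

theorem br_ne_zero {x : ℂ} (h0 : x ≠ 0) (h : x ^ 2 ≠ 1) : br x ≠ 0 := by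
  intro hx
  apply h
  have : x = x⁻¹ := sub_eq_zero.mp hx
  rw [pow_two]
  nth_rewrite 2 [this]
  exact mul_inv_cancel₀ h0

/-- The Lax operator as a matrix in the auxiliary space whose entries act on a single `ℂ²`. -/
noncomputable def ell (q x : ℂ) : Matrix (Fin 2) (Fin 2) (Matrix (Fin 2) (Fin 2) ℂ) :=
  !![!![br (x * q), 0; 0, br x], br q • sigmaMinus;
     br q • sigmaPlus, !![br x, 0; 0, br (x * q)]]

theorem lax_eq {N : ℕ} (q : ℂ) (n : Fin N) (x : ℂ) :
    lax q n x = (siteHom n).mapMatrix (ell q x) := by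
  have h1 : !![br (x * q), 0; 0, br x] =
      xPlus q x • (1 : Matrix (Fin 2) (Fin 2) ℂ) + xMinus q x • sigmaZ := by
    ext i j
    fin_cases i <;> fin_cases j <;> simp [sigmaZ, xPlus, xMinus, br] <;> ring
  have h2 : !![br x, 0; 0, br (x * q)] =
      xPlus q x • (1 : Matrix (Fin 2) (Fin 2) ℂ) - xMinus q x • sigmaZ := by
    ext i j
    fin_cases i <;> fin_cases j <;> simp [sigmaZ, xPlus, xMinus, br] <;> ring
  ext1 i j
  rw [AlgHom.mapMatrix_apply, Matrix.map_apply, ell, h1, h2, lax]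
  fin_cases i <;> fin_cases j <;> simp [← siteHom_apply, br]

/-- The six-vertex `R`-matrix, on pairs of indices of the two auxiliary spaces. -/
noncomputable def rMat (q u : ℂ) : Matrix (Fin 2 × Fin 2) (Fin 2 × Fin 2) ℂ :=
  Matrix.of fun p r =>
    if p = r then (if p.1 = p.2 then br (u * q) else br u)
    else if p = r.swap then br q else 0

/-- Twice the antisymmetrizer on two auxiliary spaces; `R` degenerates to a multiple of it at
spectral parameter `q⁻¹`. -/
def antiMat : Matrix (Fin 2 × Fin 2) (Fin 2 × Fin 2) ℂ :=
  Matrix.of fun p r => if p.1 = p.2 then 0 else if p = r then 1 else if p = r.swap then -1 else 0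

/-! ### Matrices in two auxiliary spaces -/

section Tensor

variable {S : Type*} [Ring S]

/-- The product `T₁ T'₂` of two matrices acting in two different auxiliary spaces. -/
def tens (T T' : Matrix (Fin 2) (Fin 2) S) : Matrix (Fin 2 × Fin 2) (Fin 2 × Fin 2) S :=
  Matrix.of fun p r => T p.1 r.1 * T' p.2 r.2

/-- The product `T'₂ T₁` of two matrices acting in two different auxiliary spaces. It differs
from `tens T T'` in the order in which the operator entries are multiplied. -/
def tensRev (T T' : Matrix (Fin 2) (Fin 2) S) : Matrix (Fin 2 × Fin 2) (Fin 2 × Fin 2) S :=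
  Matrix.of fun p r => T' p.2 r.2 * T p.1 r.1

theorem tens_mul {T T' U U' : Matrix (Fin 2) (Fin 2) S}
    (h : ∀ i j k l, Commute (T' i j) (U k l)) :
    tens (T * U) (T' * U') = tens T T' * tens U U' := by
  ext p r
  simp only [tens, Matrix.of_apply, Matrix.mul_apply, Fintype.sum_prod_type, Fin.sum_univ_two,
    mul_add, add_mul]
  have e : ∀ a i j k l b, a * U k l * (T' i j * b) = a * T' i j * (U k l * b) := by
    intro a i j k l b
    rw [mul_assoc, ← mul_assoc (U k l), ← (h i j k l).eq]
    simp only [mul_assoc]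
  simp only [e]
  abel

theorem tensRev_mul {T T' U U' : Matrix (Fin 2) (Fin 2) S}
    (h : ∀ i j k l, Commute (T i j) (U' k l)) :
    tensRev (T * U) (T' * U') = tensRev T T' * tensRev U U' := by
  ext p r
  simp only [tensRev, Matrix.of_apply, Matrix.mul_apply, Fintype.sum_prod_type, Fin.sum_univ_two,
    mul_add, add_mul]
  have e : ∀ a i j k l b, a * U' k l * (T i j * b) = a * T i j * (U' k l * b) := by
    intro a i j k l b
    rw [mul_assoc, ← mul_assoc (U' k l), ← (h i j k l).eq]
    simp only [mul_assoc]
  simp only [e]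

theorem tens_one : tens (1 : Matrix (Fin 2) (Fin 2) S) 1 = 1 := by
  ext ⟨i, k⟩ ⟨j, l⟩
  simp only [tens, Matrix.of_apply, Matrix.one_apply, Prod.mk.injEq]
  split_ifs <;> simp_all

theorem tensRev_one : tensRev (1 : Matrix (Fin 2) (Fin 2) S) 1 = 1 := by
  ext ⟨i, k⟩ ⟨j, l⟩
  simp only [tensRev, Matrix.of_apply, Matrix.one_apply, Prod.mk.injEq]
  split_ifs <;> simp_all

variable [Algebra ℂ S]

/-- A scalar matrix on the two auxiliary spaces, regarded as a matrix of operators. -/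
def scal (S : Type*) [Ring S] [Algebra ℂ S] (M : Matrix (Fin 2 × Fin 2) (Fin 2 × Fin 2) ℂ) :
    Matrix (Fin 2 × Fin 2) (Fin 2 × Fin 2) S :=
  M.map (algebraMap ℂ S)

/-- The `RTT` relation with spectral parameter `u`. -/
def RTT (q u : ℂ) (T T' : Matrix (Fin 2) (Fin 2) S) : Prop :=
  scal S (rMat q u) * tens T T' = tensRev T T' * scal S (rMat q u)

/-- The pair `T'`, `T` has quantum determinant `δ`: the antisymmetrizer is reproduced up to the
factor `δ`, from either side. -/
def QDet (δ : ℂ) (T T' : Matrix (Fin 2) (Fin 2) S) : Prop :=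
  tensRev T T' * scal S antiMat = δ • scal S antiMat ∧
    scal S antiMat * tens T T' = δ • scal S antiMat

theorem RTT.mul {q u : ℂ} {T T' U U' : Matrix (Fin 2) (Fin 2) S}
    (h : ∀ i j k l, Commute (T' i j) (U k l)) (h' : ∀ i j k l, Commute (T i j) (U' k l))
    (hT : RTT q u T T') (hU : RTT q u U U') : RTT q u (T * U) (T' * U') := by
  rw [RTT, tens_mul h, tensRev_mul h', ← Matrix.mul_assoc, hT, Matrix.mul_assoc, hU,
    Matrix.mul_assoc]

theorem QDet.mul {δ ε : ℂ} {T T' U U' : Matrix (Fin 2) (Fin 2) S}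
    (h : ∀ i j k l, Commute (T' i j) (U k l)) (h' : ∀ i j k l, Commute (T i j) (U' k l))
    (hT : QDet δ T T') (hU : QDet ε U U') : QDet (δ * ε) (T * U) (T' * U') := by
  constructor
  · rw [tensRev_mul h', Matrix.mul_assoc, hU.1, Matrix.mul_smul, hT.1, smul_smul, mul_comm]
  · rw [tens_mul h, ← Matrix.mul_assoc, hT.2, Matrix.smul_mul, hU.2, smul_smul]

theorem RTT.one (q u : ℂ) : RTT q u (1 : Matrix (Fin 2) (Fin 2) S) 1 := by
  rw [RTT, tens_one, tensRev_one, Matrix.mul_one, Matrix.one_mul]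

theorem QDet.one : QDet 1 (1 : Matrix (Fin 2) (Fin 2) S) 1 := by
  simp [QDet, tens_one, tensRev_one]

variable {S' : Type*} [Ring S'] [Algebra ℂ S'] (f : S →ₐ[ℂ] S')

theorem mapMatrix_tens (T T' : Matrix (Fin 2) (Fin 2) S) :
    f.mapMatrix (tens T T') = tens (f.mapMatrix T) (f.mapMatrix T') := by
  ext p r; simp [tens]

theorem mapMatrix_tensRev (T T' : Matrix (Fin 2) (Fin 2) S) :
    f.mapMatrix (tensRev T T') = tensRev (f.mapMatrix T) (f.mapMatrix T') := by
  ext p r; simp [tensRev]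

theorem mapMatrix_scal (M : Matrix (Fin 2 × Fin 2) (Fin 2 × Fin 2) ℂ) :
    f.mapMatrix (scal S M) = scal S' M := by
  ext p r; simp [scal]

theorem RTT.map {q u : ℂ} {T T' : Matrix (Fin 2) (Fin 2) S} (h : RTT q u T T') :
    RTT q u (f.mapMatrix T) (f.mapMatrix T') := by
  have := congrArg f.mapMatrix h
  rwa [map_mul, map_mul, mapMatrix_tens, mapMatrix_tensRev, mapMatrix_scal] at this

theorem QDet.map {δ : ℂ} {T T' : Matrix (Fin 2) (Fin 2) S} (h : QDet δ T T') :
    QDet δ (f.mapMatrix T) (f.mapMatrix T') := by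
  have h1 := congrArg f.mapMatrix h.1
  have h2 := congrArg f.mapMatrix h.2
  rw [map_mul, map_smul, mapMatrix_tensRev, mapMatrix_scal] at h1
  rw [map_mul, map_smul, mapMatrix_tens, mapMatrix_scal] at h2
  exact ⟨h1, h2⟩

end Tensor

/-! ### Exchange relations at one site -/

set_option maxHeartbeats 2000000 in
/-- The Yang-Baxter equation, in the form of the `RTT` relation for one site. -/
theorem ell_RTT {q x y : ℂ} (hq : q ≠ 0) (hx : x ≠ 0) (hy : y ≠ 0) :
    RTT q (x / y) (ell q x) (ell q y) := by
  rw [RTT]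
  ext ⟨i, k⟩ ⟨j, l⟩ a b
  fin_cases i <;> fin_cases k <;> fin_cases j <;> fin_cases l <;> fin_cases a <;> fin_cases b <;>
    simp [Matrix.mul_apply, Fintype.sum_prod_type, Fin.sum_univ_two, tens, tensRev, scal, rMat,
      ell, sigmaPlus, sigmaMinus, Algebra.algebraMap_eq_smul_one, br, -mul_eq_mul_left_iff,
      -mul_eq_mul_right_iff] <;> field_simp <;> ring

set_option maxHeartbeats 2000000 in
/-- The quantum determinant of one site. -/
theorem ell_QDet {q x : ℂ} (hq : q ≠ 0) (hx : x ≠ 0) :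
    QDet (br (x * q) * br (x / q)) (ell q (x / q)) (ell q x) := by
  constructor <;>
  · ext ⟨i, k⟩ ⟨j, l⟩ a b
    fin_cases i <;> fin_cases k <;> fin_cases j <;> fin_cases l <;> fin_cases a <;>
      fin_cases b <;>
    simp [Matrix.mul_apply, Fintype.sum_prod_type, Fin.sum_univ_two, tens, tensRev, scal, antiMat,
      ell, sigmaPlus, sigmaMinus, Algebra.algebraMap_eq_smul_one, br, -mul_eq_mul_left_iff,
      -mul_eq_mul_right_iff] <;> field_simp <;> ring

set_option maxHeartbeats 2000000 in
/-- At `x = 1` the Lax operator is a multiple of the permutation and at `x = 1/q` of the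
antisymmetrizer, so the product of the two factors through the antisymmetrizer of the two
auxiliary spaces. -/
theorem ell_anti {q : ℂ} (hq : q ≠ 0) :
    scal _ antiMat * tensRev (ell q (1 / q)) (ell q 1) =
      (2 : ℂ) • tensRev (ell q (1 / q)) (ell q 1) := by
  ext ⟨i, k⟩ ⟨j, l⟩ a b
  fin_cases i <;> fin_cases k <;> fin_cases j <;> fin_cases l <;> fin_cases a <;>
      fin_cases b <;>
    simp [Matrix.mul_apply, Fintype.sum_prod_type, Fin.sum_univ_two, tensRev, scal, antiMat,
      ell, sigmaPlus, sigmaMinus, Algebra.algebraMap_eq_smul_one, br, hq] <;> field_simp <;> ring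

end XXZ
namespace XXZ

/-! ### The monodromy matrix of a list of sites -/

section Chain

variable {N : ℕ} {q : ℂ} {η : Fin N → ℂ}

/-- The monodromy matrix of the part of the chain that consists of the sites in `l`. -/
noncomputable def mono (q : ℂ) (η : Fin N → ℂ) (l : List (Fin N)) (lam : ℂ) :
    Matrix (Fin 2) (Fin 2) (Op N) :=
  (l.map fun n => lax q n (lam / η n)).prod

theorem monodromy_eq (q : ℂ) (η : Fin N → ℂ) (lam : ℂ) :
    monodromy q η lam = mono q η (List.finRange N).reverse lam := by
  rw [monodromy, mono, List.ofFn_eq_map, List.map_reverse]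

theorem nodup_sites (N : ℕ) : (List.finRange N).reverse.Nodup :=
  List.nodup_reverse.mpr (List.nodup_finRange N)

theorem mono_cons (n : Fin N) (l : List (Fin N)) (lam : ℂ) :
    mono q η (n :: l) lam = lax q n (lam / η n) * mono q η l lam := by
  simp [mono]

theorem mono_append (l l' : List (Fin N)) (lam : ℂ) :
    mono q η (l ++ l') lam = mono q η l lam * mono q η l' lam := by
  simp [mono]

theorem lax_commute_siteHom {n m : Fin N} (h : n ≠ m) (x : ℂ) (i j : Fin 2)
    (X : Matrix (Fin 2) (Fin 2) ℂ) : Commute (lax q n x i j) (siteHom m X) := by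
  rw [lax_eq]
  exact siteHom_commute h _ _

theorem mono_commute_siteHom {l : List (Fin N)} {m : Fin N} (h : m ∉ l) (lam : ℂ) (i j : Fin 2)
    (X : Matrix (Fin 2) (Fin 2) ℂ) : Commute (mono q η l lam i j) (siteHom m X) := by
  induction l generalizing i j with
  | nil =>
    simp only [mono, List.map_nil, List.prod_nil, Matrix.one_apply]
    split_ifs
    · exact Commute.one_left _
    · exact Commute.zero_left _
  | cons n l ih =>
    rw [List.mem_cons, not_or] at h
    rw [mono_cons, Matrix.mul_apply]
    exact Commute.sum_left _ _ _ fun k _ =>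
      (lax_commute_siteHom (Ne.symm h.1) _ _ _ _).mul_left (ih h.2 _ _)

theorem mono_commute_lax {l : List (Fin N)} {m : Fin N} (h : m ∉ l) (lam x : ℂ)
    (i j i' j' : Fin 2) : Commute (mono q η l lam i j) (lax q m x i' j') := by
  rw [lax_eq]
  exact mono_commute_siteHom h _ _ _ _

theorem mono_commute_mono {l l' : List (Fin N)} (h : l.Disjoint l') (lam mu : ℂ)
    (i j i' j' : Fin 2) : Commute (mono q η l lam i j) (mono q η l' mu i' j') := by
  induction l' generalizing i' j' with
  | nil =>
    simp only [mono, List.map_nil, List.prod_nil, Matrix.one_apply]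
    split_ifs
    · exact Commute.one_right _
    · exact Commute.zero_right _
  | cons n l' ih =>
    rw [List.disjoint_cons_right] at h
    rw [mono_cons, Matrix.mul_apply]
    exact Commute.sum_right _ _ _ fun k _ =>
      (mono_commute_lax h.1 _ _ _ _ _ _).mul_right (ih h.2 _ _)

theorem mono_RTT (hq : q ≠ 0) (hη : ∀ n, η n ≠ 0) {lam mu : ℂ} (hl : lam ≠ 0) (hm : mu ≠ 0)
    {l : List (Fin N)} (h : l.Nodup) : RTT q (lam / mu) (mono q η l lam) (mono q η l mu) := by
  induction l with
  | nil => exact RTT.one _ _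
  | cons n l ih =>
    rw [List.nodup_cons] at h
    rw [mono_cons, mono_cons]
    refine RTT.mul (fun _ _ _ _ => (mono_commute_lax h.1 _ _ _ _ _ _).symm)
      (fun _ _ _ _ => (mono_commute_lax h.1 _ _ _ _ _ _).symm) ?_ (ih h.2)
    rw [lax_eq, lax_eq]
    have := (ell_RTT hq (div_ne_zero hl (hη n)) (div_ne_zero hm (hη n))).map (siteHom n)
    rwa [div_div_div_cancel_right₀ (hη n)] at this

/-- The quantum determinant is multiplicative along the chain. -/
theorem mono_QDet (hq : q ≠ 0) (hη : ∀ n, η n ≠ 0) {lam : ℂ} (hl : lam ≠ 0)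
    {l : List (Fin N)} (h : l.Nodup) :
    QDet (l.map fun n => br (lam / η n * q) * br (lam / η n / q)).prod
      (mono q η l (lam / q)) (mono q η l lam) := by
  induction l with
  | nil => exact QDet.one
  | cons n l ih =>
    rw [List.nodup_cons] at h
    rw [mono_cons, mono_cons, List.map_cons, List.prod_cons]
    refine QDet.mul (fun _ _ _ _ => (mono_commute_lax h.1 _ _ _ _ _ _).symm)
      (fun _ _ _ _ => (mono_commute_lax h.1 _ _ _ _ _ _).symm) ?_ (ih h.2)
    rw [lax_eq, lax_eq, div_right_comm lam q]
    exact (ell_QDet hq (div_ne_zero hl (hη n))).map (siteHom n)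

/-- At the inhomogeneity of a site `n` of the chain, the two-fold monodromy matrix factors
through the antisymmetrizer of the auxiliary spaces, so its diagonal rows vanish. -/
theorem mono_mul_eq_zero (hq : q ≠ 0) (hη : ∀ n, η n ≠ 0) {l : List (Fin N)} (h : l.Nodup)
    {n : Fin N} (hn : n ∈ l) (i j k : Fin 2) :
    mono q η l (η n) i j * mono q η l (η n / q) i k = 0 := by
  obtain ⟨l₁, l₂, rfl⟩ := List.append_of_mem hn
  rw [List.nodup_append'] at h
  obtain ⟨h1, h2, h12⟩ := h
  have h2' := List.nodup_cons.mp h2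
  have key : tensRev (mono q η (l₁ ++ n :: l₂) (η n / q)) (mono q η (l₁ ++ n :: l₂) (η n)) =
      tensRev (mono q η l₁ (η n / q)) (mono q η l₁ (η n)) *
        (tensRev (lax q n (η n / q / η n)) (lax q n (η n / η n)) *
        tensRev (mono q η l₂ (η n / q)) (mono q η l₂ (η n))) := by
    rw [mono_append, mono_append, tensRev_mul fun _ _ _ _ => mono_commute_mono h12 _ _ _ _ _ _,
      mono_cons, mono_cons, tensRev_mul fun _ _ _ _ => (mono_commute_lax h2'.1 _ _ _ _ _ _).symm]
  have hanti : scal (Op N) antiMat * tensRev (lax q n (1 / q)) (lax q n 1) =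
      (2 : ℂ) • tensRev (lax q n (1 / q)) (lax q n 1) := by
    have := congrArg (siteHom n).mapMatrix (ell_anti hq)
    rwa [map_mul, map_smul, mapMatrix_tensRev, mapMatrix_scal, ← lax_eq, ← lax_eq] at this
  rw [div_self (hη n), div_right_comm, div_self (hη n)] at key
  have hX := (mono_QDet hq hη (hη n) h1).1
  set Z := tensRev (mono q η l₂ (η n / q)) (mono q η l₂ (η n))
  have h3 : (2 : ℂ) • tensRev (mono q η (l₁ ++ n :: l₂) (η n / q))
      (mono q η (l₁ ++ n :: l₂) (η n)) = scal (Op N) antiMat *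
        ((l₁.map fun m => br (η n / η m * q) * br (η n / η m / q)).prod •
          (tensRev (lax q n (1 / q)) (lax q n 1) * Z)) := by
    rw [key, ← Matrix.mul_smul, ← Matrix.smul_mul, ← hanti, Matrix.mul_assoc,
      ← Matrix.mul_assoc, hX, Matrix.smul_mul, Matrix.mul_smul]
  have h4 := congrFun (congrFun h3 (i, i)) (k, j)
  rw [Matrix.smul_apply, Matrix.mul_apply] at h4
  simp only [scal, antiMat, Matrix.map_apply, Matrix.of_apply, if_true, map_zero, zero_mul,
    Finset.sum_const_zero, tensRev] at h4
  simpa using h4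

theorem Op.mul_mulVec {N : ℕ} (X Y : Op N) (v : Spins N → ℂ) : (X * Y) *ᵥ v = X *ᵥ (Y *ᵥ v) :=
  (Matrix.mulVec_mulVec _ _ _).symm

theorem Op.vecMul_mul {N : ℕ} (X Y : Op N) (v : Spins N → ℂ) : v ᵥ* (X * Y) = (v ᵥ* X) ᵥ* Y :=
  (Matrix.vecMul_vecMul _ _ _).symm

theorem lax_mulVec_refState (n : Fin N) (x : ℂ) :
    lax q n x 0 0 *ᵥ refState N = br (x * q) • refState N ∧
    lax q n x 1 0 *ᵥ refState N = 0 ∧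
    lax q n x 1 1 *ᵥ refState N = br x • refState N := by
  have hc : ∀ s : Spins N, (s n = 1) → refState N s = 0 := by
    intro s hs
    rw [refState, Pi.single_apply, if_neg]
    rintro rfl
    simp at hs
  have hs : ∀ (s : Spins N) (x : Fin 2), s n = x → Function.update s n x = s :=
    fun s x h => by rw [← h, Function.update_eq_self]
  rw [lax_eq]
  refine ⟨?_, ?_, ?_⟩ <;> funext s <;>
  · rcases Fin.exists_fin_two.mp ⟨s n, rfl⟩ with h | h <;>
    · simp [siteHom_apply, siteOp_mulVec, ell, h, Fin.sum_univ_two, sigmaPlus, hs s _ h, hc]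

theorem refState_vecMul_lax (n : Fin N) (x : ℂ) :
    refState N ᵥ* lax q n x 0 0 = br (x * q) • refState N ∧
    refState N ᵥ* lax q n x 0 1 = 0 ∧
    refState N ᵥ* lax q n x 1 1 = br x • refState N := by
  have ht : ∀ X : Matrix (Fin 2) (Fin 2) ℂ, (siteHom n X)ᵀ = siteHom n Xᵀ := by
    intro X
    ext s t
    simp only [siteHom_apply, siteOp, Matrix.transpose_apply, eq_comm]
  have h := lax_mulVec_refState (q := q) n x
  have e : ∀ i j, (lax q n x i j)ᵀ = lax q n x j i := by
    intro i j
    rw [lax_eq, AlgHom.mapMatrix_apply, Matrix.map_apply, Matrix.map_apply, ht]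
    congr 1
    fin_cases i <;> fin_cases j <;> ext a b <;> fin_cases a <;> fin_cases b <;>
      simp [ell, sigmaPlus, sigmaMinus]
  rw [← Matrix.mulVec_transpose, ← Matrix.mulVec_transpose, ← Matrix.mulVec_transpose, e, e, e]
  exact h

theorem mono_mulVec_refState {l : List (Fin N)} (h : l.Nodup) (lam : ℂ) :
    mono q η l lam 0 0 *ᵥ refState N = (l.map fun n => br (lam / η n * q)).prod • refState N ∧
    mono q η l lam 1 0 *ᵥ refState N = 0 ∧
    mono q η l lam 1 1 *ᵥ refState N = (l.map fun n => br (lam / η n)).prod • refState N := by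
  induction l with
  | nil => simp [mono]
  | cons n l ih =>
    rw [List.nodup_cons] at h
    obtain ⟨i1, i2, i3⟩ := ih h.2
    obtain ⟨h1, h2, h3⟩ := lax_mulVec_refState (q := q) n (lam / η n)
    have hc := fun i j i' j' =>
      (mono_commute_lax (q := q) (η := η) h.1 lam (lam / η n) i j i' j').eq.symm
    simp only [mono_cons, Matrix.mul_apply, Fin.sum_univ_two, Matrix.add_mulVec, List.map_cons,
      List.prod_cons]
    refine ⟨?_, ?_, ?_⟩
    · rw [Op.mul_mulVec, i1, Op.mul_mulVec, i2, Matrix.mulVec_smul, h1, smul_smul,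
        Matrix.mulVec_zero, add_zero, mul_comm]
    · rw [Op.mul_mulVec, i1, Op.mul_mulVec, i2, Matrix.mulVec_smul, h2]
      simp
    · rw [hc, Op.mul_mulVec, h2, Op.mul_mulVec, i3, Matrix.mulVec_smul, h3, smul_smul,
        Matrix.mulVec_zero, zero_add, mul_comm]

theorem refState_vecMul_mono {l : List (Fin N)} (h : l.Nodup) (lam : ℂ) :
    refState N ᵥ* mono q η l lam 0 0 = (l.map fun n => br (lam / η n * q)).prod • refState N ∧
    refState N ᵥ* mono q η l lam 0 1 = 0 ∧
    refState N ᵥ* mono q η l lam 1 1 = (l.map fun n => br (lam / η n)).prod • refState N := by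
  induction l with
  | nil => simp [mono]
  | cons n l ih =>
    rw [List.nodup_cons] at h
    obtain ⟨i1, i2, i3⟩ := ih h.2
    obtain ⟨h1, h2, h3⟩ := refState_vecMul_lax (q := q) n (lam / η n)
    have hc := fun i j i' j' =>
      (mono_commute_lax (q := q) (η := η) h.1 lam (lam / η n) i j i' j').eq.symm
    simp only [mono_cons, Matrix.mul_apply, Fin.sum_univ_two, Matrix.vecMul_add, List.map_cons,
      List.prod_cons]
    refine ⟨?_, ?_, ?_⟩
    · rw [Op.vecMul_mul, h1, Op.vecMul_mul, h2, Matrix.smul_vecMul, i1, smul_smul,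
        Matrix.zero_vecMul, add_zero]
    · rw [Op.vecMul_mul, h1, Op.vecMul_mul, h2, Matrix.smul_vecMul, i2]
      simp
    · rw [hc, Op.vecMul_mul, i2, Op.vecMul_mul, h3, Matrix.smul_vecMul, i3, smul_smul,
        Matrix.zero_vecMul, zero_add]

end Chain

/-! ### Laurent polynomials of definite parity -/

open Polynomial in
/-- On `ℂ \ {0}`, `f` is a Laurent polynomial with exponents `-n, -n + 2, …, n`. -/
def EvenLaurent (n : ℕ) (f : ℂ → ℂ) : Prop :=
  ∃ P : ℂ[X], P.degree < (n + 1 : ℕ) ∧ ∀ x, x ≠ 0 → x ^ n * f x = P.eval (x ^ 2)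

open Polynomial in
/-- On `ℂ \ {0}`, `f` is a Laurent polynomial with exponents `-n + 1, -n + 3, …, n - 1`;
for `n = 0` it vanishes there. -/
def OddLaurent (n : ℕ) (f : ℂ → ℂ) : Prop :=
  ∃ P : ℂ[X], P.degree < n ∧ ∀ x, x ≠ 0 → x ^ n * f x = x * P.eval (x ^ 2)

section Laurent

open Polynomial

theorem mul_degree_lt {P Q : ℂ[X]} {a b c : ℕ} (hP : P.degree < a) (hQ : Q.degree < b)
    (h : a + b ≤ c + 1) : (P * Q).degree < c := by
  by_cases hP0 : P = 0
  · simp [hP0, bot_lt_iff_ne_bot]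
  by_cases hQ0 : Q = 0
  · simp [hQ0, bot_lt_iff_ne_bot]
  rw [degree_mul, degree_eq_natDegree hP0, degree_eq_natDegree hQ0] at *
  norm_cast at *
  omega

theorem EvenLaurent.mul {n m : ℕ} {f g : ℂ → ℂ} (hf : EvenLaurent n f) (hg : EvenLaurent m g) :
    EvenLaurent (n + m) fun x => f x * g x := by
  obtain ⟨P, hP, hP'⟩ := hf
  obtain ⟨Q, hQ, hQ'⟩ := hg
  refine ⟨P * Q, mul_degree_lt hP hQ (by omega), fun x hx => ?_⟩
  rw [eval_mul, ← hP' x hx, ← hQ' x hx]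
  ring

theorem EvenLaurent.mul_odd {n m : ℕ} {f g : ℂ → ℂ} (hf : EvenLaurent n f)
    (hg : OddLaurent m g) : OddLaurent (n + m) fun x => f x * g x := by
  obtain ⟨P, hP, hP'⟩ := hf
  obtain ⟨Q, hQ, hQ'⟩ := hg
  refine ⟨P * Q, mul_degree_lt hP hQ (by omega), fun x hx => ?_⟩
  rw [eval_mul, ← hP' x hx, pow_add, mul_mul_mul_comm, hQ' x hx]
  ring

theorem OddLaurent.mul_even {n m : ℕ} {f g : ℂ → ℂ} (hf : OddLaurent n f)
    (hg : EvenLaurent m g) : OddLaurent (n + m) fun x => f x * g x := by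
  simpa only [mul_comm, add_comm] using hg.mul_odd hf

theorem OddLaurent.mul {n m : ℕ} {f g : ℂ → ℂ} (hf : OddLaurent n f) (hg : OddLaurent m g) :
    EvenLaurent (n + m) fun x => f x * g x := by
  obtain ⟨P, hP, hP'⟩ := hf
  obtain ⟨Q, hQ, hQ'⟩ := hg
  refine ⟨X * (P * Q), ?_, fun x hx => ?_⟩
  · by_cases hP0 : P = 0
    · simp [hP0, bot_lt_iff_ne_bot]
    by_cases hQ0 : Q = 0
    · simp [hQ0, bot_lt_iff_ne_bot]
    rw [degree_mul, degree_mul, degree_X, degree_eq_natDegree hP0, degree_eq_natDegree hQ0] at *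
    norm_cast at *
    omega
  · rw [eval_mul, eval_mul, eval_X, pow_add, mul_mul_mul_comm, hP' x hx, hQ' x hx]
    ring

theorem EvenLaurent.add {n : ℕ} {f g : ℂ → ℂ} (hf : EvenLaurent n f) (hg : EvenLaurent n g) :
    EvenLaurent n fun x => f x + g x := by
  obtain ⟨P, hP, hP'⟩ := hf
  obtain ⟨Q, hQ, hQ'⟩ := hg
  refine ⟨P + Q, (degree_add_le _ _).trans_lt (max_lt hP hQ), fun x hx => ?_⟩
  rw [eval_add, ← hP' x hx, ← hQ' x hx]
  ring

theorem OddLaurent.add {n : ℕ} {f g : ℂ → ℂ} (hf : OddLaurent n f) (hg : OddLaurent n g) :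
    OddLaurent n fun x => f x + g x := by
  obtain ⟨P, hP, hP'⟩ := hf
  obtain ⟨Q, hQ, hQ'⟩ := hg
  refine ⟨P + Q, (degree_add_le _ _).trans_lt (max_lt hP hQ), fun x hx => ?_⟩
  rw [eval_add, mul_add, mul_add, ← hP' x hx, ← hQ' x hx]

theorem EvenLaurent.zero (n : ℕ) : EvenLaurent n fun _ => 0 :=
  ⟨0, by simp [bot_lt_iff_ne_bot], by simp⟩

theorem OddLaurent.zero (n : ℕ) : OddLaurent n fun _ => 0 :=
  ⟨0, by simp [bot_lt_iff_ne_bot], by simp⟩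

theorem EvenLaurent.const (c : ℂ) : EvenLaurent 0 fun _ => c :=
  ⟨C c, by simpa using degree_C_lt, by simp⟩

theorem OddLaurent.const (c : ℂ) : OddLaurent 1 fun _ => c :=
  ⟨C c, by simpa using degree_C_lt, by simp⟩

theorem EvenLaurent.sum {ι : Type*} {n : ℕ} (s : Finset ι) {f : ι → ℂ → ℂ}
    (h : ∀ i ∈ s, EvenLaurent n (f i)) : EvenLaurent n fun x => ∑ i ∈ s, f i x := by
  classical
  induction s using Finset.induction_on with
  | empty => simpa using EvenLaurent.zero n
  | insert a s ha ih =>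
    simp only [Finset.sum_insert ha]
    exact (h a (by simp)).add (ih fun i hi => h i (by simp [hi]))

theorem OddLaurent.sum {ι : Type*} {n : ℕ} (s : Finset ι) {f : ι → ℂ → ℂ}
    (h : ∀ i ∈ s, OddLaurent n (f i)) : OddLaurent n fun x => ∑ i ∈ s, f i x := by
  classical
  induction s using Finset.induction_on with
  | empty => simpa using OddLaurent.zero n
  | insert a s ha ih =>
    simp only [Finset.sum_insert ha]
    exact (h a (by simp)).add (ih fun i hi => h i (by simp [hi]))

theorem EvenLaurent.prod {ι : Type*} (s : Finset ι) {f : ι → ℂ → ℂ}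
    (h : ∀ i ∈ s, EvenLaurent 1 (f i)) : EvenLaurent s.card fun x => ∏ i ∈ s, f i x := by
  classical
  induction s using Finset.induction_on with
  | empty => simpa using EvenLaurent.const 1
  | insert a s ha ih =>
    simp only [Finset.prod_insert ha, Finset.card_insert_of_notMem ha]
    rw [add_comm]
    exact (h a (by simp)).mul (ih fun i hi => h i (by simp [hi]))

theorem evenLaurent_br {c : ℂ} (hc : c ≠ 0) : EvenLaurent 1 fun x => br (x * c) := by
  refine ⟨C c * X - C c⁻¹, ?_, fun x hx => ?_⟩
  · refine (degree_sub_le _ _).trans_lt (max_lt ?_ ?_)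
    · exact (degree_C_mul_X_le c).trans_lt (by norm_num)
    · exact degree_C_le.trans_lt (by norm_num)
  · simp [br]
    field_simp

theorem EvenLaurent.continuousOn {n : ℕ} {f : ℂ → ℂ} (h : EvenLaurent n f) :
    ContinuousOn f {0}ᶜ := by
  obtain ⟨P, -, hP⟩ := h
  have : ContinuousOn (fun x : ℂ => (x ^ n)⁻¹ * P.eval (x ^ 2)) {0}ᶜ := by
    refine ContinuousOn.mul (ContinuousOn.inv₀ (by fun_prop) fun x hx => pow_ne_zero _ hx) ?_
    exact (P.continuous.comp (continuous_pow 2)).continuousOn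
  refine this.congr fun x hx => ?_
  dsimp only
  rw [← hP x hx, inv_mul_cancel_left₀ (pow_ne_zero _ hx)]

theorem OddLaurent.continuousOn {n : ℕ} {f : ℂ → ℂ} (h : OddLaurent n f) :
    ContinuousOn f {0}ᶜ := by
  obtain ⟨P, -, hP⟩ := h
  have : ContinuousOn (fun x : ℂ => (x ^ n)⁻¹ * (x * P.eval (x ^ 2))) {0}ᶜ := by
    refine ContinuousOn.mul (ContinuousOn.inv₀ (by fun_prop) fun x hx => pow_ne_zero _ hx) ?_
    exact (continuous_id.mul (P.continuous.comp (continuous_pow 2))).continuousOn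
  refine this.congr fun x hx => ?_
  dsimp only
  rw [← hP x hx, inv_mul_cancel_left₀ (pow_ne_zero _ hx)]

/-- An odd Laurent polynomial of `n` terms is determined by its values at `n` points whose
squares are distinct. -/
theorem OddLaurent.eq_of_eq_on_nodes {n : ℕ} {f g : ℂ → ℂ} (hf : OddLaurent n f)
    (hg : OddLaurent n g) {ξ : Fin n → ℂ} (h0 : ∀ a, ξ a ≠ 0)
    (hξ : ∀ a b, a ≠ b → ξ a ^ 2 ≠ ξ b ^ 2) (h : ∀ a, f (ξ a) = g (ξ a)) {x : ℂ} (hx : x ≠ 0) :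
    f x = g x := by
  obtain ⟨P, hP, hP'⟩ := hf
  obtain ⟨Q, hQ, hQ'⟩ := hg
  have hPQ : P = Q := by
    refine Polynomial.eq_of_degrees_lt_of_eval_index_eq (s := Finset.univ)
      (v := fun a => ξ a ^ 2) ?_ ?_ ?_ ?_
    · intro a _ b _ hab
      by_contra hne
      exact hξ a b hne hab
    · simpa using hP
    · simpa using hQ
    · intro a _
      have h1 := hP' _ (h0 a)
      rw [h a, hQ' _ (h0 a)] at h1
      exact (mul_left_cancel₀ (h0 a) h1).symm
  have h1 := hP' x hx
  rw [hPQ, ← hQ' x hx] at h1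
  exact mul_left_cancel₀ (pow_ne_zero _ hx) h1

theorem EvenLaurent.const_mul {n : ℕ} {f : ℂ → ℂ} (c : ℂ) (h : EvenLaurent n f) :
    EvenLaurent n fun x => c * f x := by
  simpa using (EvenLaurent.const c).mul h

theorem OddLaurent.const_mul {n : ℕ} {f : ℂ → ℂ} (c : ℂ) (h : OddLaurent n f) :
    OddLaurent n fun x => c * f x := by
  simpa using (EvenLaurent.const c).mul_odd h

/-- The parity of the entry `(i, j)` of a monodromy matrix: even on the diagonal and odd off
the diagonal. -/
def EntryLaurent (i j : Fin 2) (n : ℕ) (f : ℂ → ℂ) : Prop :=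
  if i = j then EvenLaurent n f else OddLaurent n f

theorem EntryLaurent.mul {i j k : Fin 2} {n m : ℕ} {f g : ℂ → ℂ} (hf : EntryLaurent i k n f)
    (hg : EntryLaurent k j m g) : EntryLaurent i j (n + m) fun x => f x * g x := by
  fin_cases i <;> fin_cases j <;> fin_cases k <;>
    simp only [EntryLaurent, Fin.zero_eta, Fin.mk_one, zero_ne_one, one_ne_zero, if_true,
      if_false] at * <;>
    first
      | exact EvenLaurent.mul hf hg
      | exact EvenLaurent.mul_odd hf hg
      | exact OddLaurent.mul_even hf hg
      | exact OddLaurent.mul hf hg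

theorem EntryLaurent.sum {ι : Type*} {i j : Fin 2} {n : ℕ} (s : Finset ι) {f : ι → ℂ → ℂ}
    (h : ∀ a ∈ s, EntryLaurent i j n (f a)) : EntryLaurent i j n fun x => ∑ a ∈ s, f a x := by
  unfold EntryLaurent at *
  split_ifs with hij
  · exact EvenLaurent.sum s fun a ha => by simpa [hij] using h a ha
  · exact OddLaurent.sum s fun a ha => by simpa [hij] using h a ha

theorem EntryLaurent.zero (i j : Fin 2) (n : ℕ) : EntryLaurent i j n fun _ => 0 := by
  unfold EntryLaurent
  split_ifs
  · exact EvenLaurent.zero n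
  · exact OddLaurent.zero n

theorem ell_entryLaurent {q c : ℂ} (hq : q ≠ 0) (hc : c ≠ 0) (i j a b : Fin 2) :
    EntryLaurent i j 1 fun lam => ell q (lam / c) i j a b := by
  have h1 : EvenLaurent 1 fun lam => br (lam / c) := by
    simpa only [div_eq_mul_inv] using evenLaurent_br (inv_ne_zero hc)
  have h2 : EvenLaurent 1 fun lam => br (lam / c * q) := by
    simpa only [div_eq_mul_inv, mul_assoc] using evenLaurent_br (mul_ne_zero (inv_ne_zero hc) hq)
  fin_cases i <;> fin_cases j <;> fin_cases a <;> fin_cases b <;>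
    simp [EntryLaurent, ell, sigmaPlus, sigmaMinus, h1, h2, EvenLaurent.zero, OddLaurent.zero,
      OddLaurent.const]

theorem mono_entryLaurent {N : ℕ} {q : ℂ} {η : Fin N → ℂ} (hq : q ≠ 0) (hη : ∀ n, η n ≠ 0)
    (l : List (Fin N)) (i j : Fin 2) (s t : Spins N) :
    EntryLaurent i j l.length fun lam => mono q η l lam i j s t := by
  induction l generalizing i j s t with
  | nil =>
    simp only [mono, List.map_nil, List.prod_nil, List.length_nil, EntryLaurent, Matrix.one_apply]
    split_ifs
    · exact EvenLaurent.const _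
    · exact OddLaurent.zero _
  | cons n l ih =>
    simp only [mono_cons, Matrix.mul_apply, Matrix.sum_apply, List.length_cons]
    rw [add_comm]
    refine EntryLaurent.sum _ fun k _ => EntryLaurent.sum _ fun u _ =>
      EntryLaurent.mul (k := k) ?_ (ih k j u t)
    simp only [lax_eq, AlgHom.mapMatrix_apply, Matrix.map_apply, siteHom_apply, siteOp]
    split_ifs
    · exact ell_entryLaurent hq (hη n) i k _ _
    · exact EntryLaurent.zero i k 1

open Filter Topology in
theorem eq_of_eq_off_finite {E : Type*} [TopologicalSpace E] [T2Space E] {f g : ℂ → E}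
    (hf : ContinuousOn f {0}ᶜ) (hg : ContinuousOn g {0}ᶜ) {S : Set ℂ} (hS : S.Finite)
    (h : ∀ x, x ≠ 0 → x ∉ S → f x = g x) {x : ℂ} (hx : x ≠ 0) : f x = g x := by
  have h0 : ({0}ᶜ : Set ℂ) ∈ 𝓝 x := isOpen_compl_singleton.mem_nhds hx
  have h1 : (S \ {x})ᶜ ∈ 𝓝 x :=
    (hS.subset Set.sdiff_subset).isClosed.isOpen_compl.mem_nhds (by simp)
  have hfx := (hf.continuousAt h0).tendsto.mono_left (nhdsWithin_le_nhds (s := {x}ᶜ))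
  have hgx := (hg.continuousAt h0).tendsto.mono_left (nhdsWithin_le_nhds (s := {x}ᶜ))
  refine tendsto_nhds_unique (hfx.congr' ?_) hgx
  filter_upwards [mem_nhdsWithin_of_mem_nhds h0, mem_nhdsWithin_of_mem_nhds h1,
    self_mem_nhdsWithin] with y hy0 hy1 hy2
  exact h y hy0 fun hyS => hy1 ⟨hyS, hy2⟩

theorem br_div_eq_zero {x c : ℂ} (hx : x ≠ 0) (hc : c ≠ 0) (h : br (x / c) = 0) :
    x ^ 2 = c ^ 2 := by
  by_contra hne
  refine br_ne_zero (div_ne_zero hx hc) (fun h1 => hne ?_) h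
  rwa [div_pow, div_eq_one_iff_eq (pow_ne_zero _ hc)] at h1

theorem br_div_ne_zero {x c : ℂ} (hx : x ≠ 0) (hc : c ≠ 0) (h : x ^ 2 ≠ c ^ 2) :
    br (x / c) ≠ 0 := fun h0 => h (br_div_eq_zero hx hc h0)

theorem finite_sq_eq (c : ℂ) : {x : ℂ | x ^ 2 = c ^ 2}.Finite := by
  refine (Set.toFinite {c, -c}).subset fun x hx => ?_
  simpa using sq_eq_sq_iff_eq_or_eq_neg.mp hx

end Laurent

end XXZ
namespace XXZ

/-! ### Separate bases -/

section Separation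

variable {N : ℕ} {q : ℂ} {η : Fin N → ℂ}

/-- The zero `η_a q^{-i}` of the eigenvalues `d_h` with `h_a = i`; the other such zero is its
negative. -/
noncomputable def node (q : ℂ) (η : Fin N → ℂ) (a : Fin N) (i : Fin 2) : ℂ :=
  η a / q ^ (i : ℕ)

/-- The zeros of the eigenvalues of `D` are nonzero, and distinct up to sign. -/
structure Generic (q : ℂ) (η : Fin N → ℂ) : Prop where
  q_ne : q ≠ 0
  η_ne : ∀ a, η a ≠ 0
  node_ne : ∀ a b i j, (a, i) ≠ (b, j) → node q η a i ^ 2 ≠ node q η b j ^ 2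

theorem node_zero (a : Fin N) : node q η a 0 = η a := by simp [node]

theorem node_one (a : Fin N) : node q η a 1 = η a / q := by simp [node]

theorem Generic.node_ne_zero (hg : Generic q η) (a : Fin N) (i : Fin 2) : node q η a i ≠ 0 :=
  div_ne_zero (hg.η_ne a) (pow_ne_zero _ hg.q_ne)

theorem dEigen_eq (h : Spins N) (lam : ℂ) :
    dEigen q η h lam = ∏ n, br (lam / node q η n (h n)) := by
  simp only [dEigen, node, br_div, div_div_eq_mul_div]

theorem interp_eq (hq : q ≠ 0) (h : Spins N) (a : Fin N) (lam : ℂ) :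
    interp q η h a lam = ∏ b ∈ Finset.univ.erase a,
      br (lam / node q η b (h b)) / br (node q η a (h a) / node q η b (h b)) := by
  refine Finset.prod_congr rfl fun b _ => ?_
  have e : η a * q ^ (((h b : ℕ) : ℤ) - ((h a : ℕ) : ℤ)) / η b =
      node q η a (h a) / node q η b (h b) := by
    rw [zpow_sub₀ hq, zpow_natCast, zpow_natCast, node, node, div_div_eq_mul_div]
    ring
  have e' : η b / (q ^ (((h b : ℕ) : ℤ) - ((h a : ℕ) : ℤ)) * η a) =
      (node q η a (h a) / node q η b (h b))⁻¹ := by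
    rw [← e, inv_div, mul_comm]
  have e2 : lam * q ^ (h b : ℕ) / η b = lam / node q η b (h b) := by
    rw [node, div_div_eq_mul_div]
  have e3 : η b / (q ^ (h b : ℕ) * lam) = node q η b (h b) / lam := by
    rw [node, div_div]
  rw [e, e', e2, e3, br_div, br]

theorem dEigen_node (hg : Generic q η) (h : Spins N) (a : Fin N) :
    dEigen q η h (node q η a (h a)) = 0 := by
  rw [dEigen_eq]
  refine Finset.prod_eq_zero (Finset.mem_univ a) ?_
  rw [div_self (hg.node_ne_zero a _)]
  simp [br]

theorem dEigen_ne_zero (hg : Generic q η) {h : Spins N} {lam : ℂ} (hl : lam ≠ 0)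
    (hne : ∀ a, lam ^ 2 ≠ node q η a (h a) ^ 2) : dEigen q η h lam ≠ 0 := by
  rw [dEigen_eq]
  exact Finset.prod_ne_zero_iff.mpr fun a _ => br_div_ne_zero hl (hg.node_ne_zero a _) (hne a)

theorem dEigen_evenLaurent (hg : Generic q η) (h : Spins N) :
    EvenLaurent N (dEigen q η h) := by
  have : EvenLaurent (Finset.univ : Finset (Fin N)).card
      fun lam => ∏ n, br (lam / node q η n (h n)) :=
    EvenLaurent.prod _ fun n _ => by
      simpa only [div_eq_mul_inv] using evenLaurent_br (inv_ne_zero (hg.node_ne_zero n (h n)))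
  rw [Finset.card_univ, Fintype.card_fin] at this
  simpa only [← dEigen_eq] using this

theorem interp_oddLaurent (hg : Generic q η) (h : Spins N) (a : Fin N) :
    OddLaurent N (interp q η h a) := by
  have h1 : EvenLaurent (Finset.univ.erase a).card (interp q η h a) := by
    have := EvenLaurent.prod (Finset.univ.erase a) (f := fun b lam =>
      br (lam / node q η b (h b)) / br (node q η a (h a) / node q η b (h b))) fun b _ => by
        have := (evenLaurent_br (inv_ne_zero (hg.node_ne_zero b (h b)))).const_mul
          (br (node q η a (h a) / node q η b (h b)))⁻¹
        simpa only [div_eq_mul_inv, mul_comm] using this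
    simpa only [← interp_eq hg.q_ne] using this
  have h2 := (OddLaurent.const 1).mul_even h1
  have h3 : 1 + (Finset.univ.erase a).card = N := by
    rw [Finset.card_erase_of_mem (Finset.mem_univ a), Finset.card_univ, Fintype.card_fin]
    have := a.pos
    omega
  rw [h3] at h2
  simpa using h2

theorem interp_self (hg : Generic q η) (h : Spins N) (a : Fin N) :
    interp q η h a (node q η a (h a)) = 1 := by
  rw [interp_eq hg.q_ne]
  refine Finset.prod_eq_one fun b hb => div_self ?_
  refine br_div_ne_zero (hg.node_ne_zero a _) (hg.node_ne_zero b _) (hg.node_ne _ _ _ _ ?_)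
  exact fun e => Finset.ne_of_mem_erase hb (congrArg Prod.fst e).symm

theorem interp_of_ne (hg : Generic q η) (h : Spins N) {a b : Fin N} (hab : a ≠ b) :
    interp q η h a (node q η b (h b)) = 0 := by
  rw [interp_eq hg.q_ne]
  refine Finset.prod_eq_zero (Finset.mem_erase.mpr ⟨hab.symm, Finset.mem_univ b⟩) ?_
  rw [div_self (hg.node_ne_zero b _)]
  simp [br]

theorem dEigen_update {h : Spins N} {a : Fin N} (ha : h a = 0) (lam : ℂ) :
    dEigen q η (Function.update h a 1) lam * br (lam / η a) =
      dEigen q η h lam * br (lam / η a * q) := by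
  rw [dEigen_eq, dEigen_eq, ← Finset.mul_prod_erase _ _ (Finset.mem_univ a),
    ← Finset.mul_prod_erase _ (fun n => br (lam / node q η n (h n))) (Finset.mem_univ a),
    Function.update_self, ha, node_zero, node_one, div_div_eq_mul_div, div_mul_eq_mul_div]
  have : ∏ n ∈ Finset.univ.erase a, br (lam / node q η n (Function.update h a 1 n)) =
      ∏ n ∈ Finset.univ.erase a, br (lam / node q η n (h n)) :=
    Finset.prod_congr rfl fun n hn => by
      rw [Function.update_of_ne (Finset.ne_of_mem_erase hn)]
  rw [this]
  ring

/-- Every `h ∈ {0,1}^N` arises from `0` by raising entries from `0` to `1`. -/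
theorem spins_induction {P : Spins N → Prop} (h0 : P fun _ => 0)
    (hs : ∀ h a, h a = 0 → P h → P (Function.update h a 1)) (h : Spins N) : P h := by
  have key : ∀ s : Finset (Fin N), P fun n => if n ∈ s then 1 else 0 := by
    intro s
    induction s using Finset.induction_on with
    | empty => simpa using h0
    | insert a s ha ih =>
      convert hs _ a (by simp [ha]) ih using 1
      funext n
      by_cases hn : n = a
      · subst hn; simp
      · simp [hn]
  convert key (Finset.univ.filter fun n => h n = 1) using 1
  funext n
  rcases Fin.exists_fin_two.mp ⟨h n, rfl⟩ with e | e <;> simp [e]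

/-- A family `ψ` of states that is generated from a reference state by a raising operator `R`,
and the part of the Yang-Baxter algebra that determines the action of `D`, of `R` and of the
lowering operator `L` on it. Right states are the case `R = B`, `L = C`; left states are the case
in which `R`, `L`, `A`, `D` are the transposes of `C`, `B`, `A`, `D`. -/
structure SeparateStates (q : ℂ) (η : Fin N → ℂ) (A D R L : ℂ → Op N) (κ κ' : Fin N → ℂ)
    (ψ : Spins N → Spins N → ℂ) : Prop where
  diag_raise : ∀ lam mu, lam ≠ 0 → mu ≠ 0 → br (lam / mu) • (D lam * R mu) =
    br (lam / mu * q) • (R mu * D lam) - br q • (R lam * D mu)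
  lower_raise : ∀ lam mu, lam ≠ 0 → mu ≠ 0 → br (lam / mu) • (L lam * R mu - R mu * L lam) =
    br q • (A mu * D lam - A lam * D mu)
  qdet : ∀ a, A (η a / q) * D (η a) - L (η a / q) * R (η a) = -((κ a * κ' a) • (1 : Op N))
  raise_raise : ∀ a, R (η a / q) * R (η a) = 0
  diag_laurent : ∀ s t, EvenLaurent N fun lam => D lam s t
  raise_laurent : ∀ s t, OddLaurent N fun lam => R lam s t
  lower_laurent : ∀ s t, OddLaurent N fun lam => L lam s t
  diag_ref : ∀ lam, D lam *ᵥ ψ (fun _ => 0) = dFun η lam • ψ (fun _ => 0)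
  lower_ref : ∀ lam, L lam *ᵥ ψ (fun _ => 0) = 0
  ref_ne : ψ (fun _ => 0) ≠ 0
  κ_ne : ∀ a, κ a ≠ 0
  κ'_ne : ∀ a, κ' a ≠ 0
  raise : ∀ h a, h a = 0 → ψ (Function.update h a 1) = (κ a)⁻¹ • (R (η a) *ᵥ ψ h)

namespace SeparateStates

variable {A D R L : ℂ → Op N} {κ κ' : Fin N → ℂ} {ψ : Spins N → Spins N → ℂ}

theorem diag_apply (H : SeparateStates q η A D R L κ κ' ψ) (hg : Generic q η) (h : Spins N)
    {lam : ℂ} (hl : lam ≠ 0) : D lam *ᵥ ψ h = dEigen q η h lam • ψ h := by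
  induction h using spins_induction generalizing lam with
  | h0 => simpa [dEigen, dFun] using H.diag_ref lam
  | hs h a ha ih =>
    -- the exchange relation determines `D(lam)` only where `br (lam / η a)` does not vanish
    have hcont : ContinuousOn (fun lam => D lam *ᵥ ψ (Function.update h a 1)) {0}ᶜ := by
      refine continuousOn_pi.mpr fun s => continuousOn_finsetSum _ fun t _ => ?_
      exact (H.diag_laurent s t).continuousOn.mul continuousOn_const
    refine eq_of_eq_off_finite hcont
      (g := fun lam => dEigen q η (Function.update h a 1) lam • ψ (Function.update h a 1))
      ((dEigen_evenLaurent hg _).continuousOn.smul continuousOn_const)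
      (finite_sq_eq (η a)) (fun mu hmu hne => ?_) hl
    have hbr : br (mu / η a) ≠ 0 := br_div_ne_zero hmu (hg.η_ne a) hne
    have h0 : D (η a) *ᵥ ψ h = 0 := by
      rw [ih (hg.η_ne a), ← node_zero (q := q) (η := η) a, ← ha, dEigen_node hg, zero_smul]
    have h1 := congrArg (· *ᵥ ψ h) (H.diag_raise mu (η a) hmu (hg.η_ne a))
    simp only [Matrix.sub_mulVec, Matrix.smul_mulVec, Op.mul_mulVec, h0, ih hmu,
      Matrix.mulVec_zero, smul_zero, sub_zero, Matrix.mulVec_smul, smul_smul] at h1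
    rw [mul_comm _ (dEigen q η h mu), ← dEigen_update ha, mul_comm, mul_smul] at h1
    rw [H.raise h a ha, Matrix.mulVec_smul, smul_comm, smul_right_injective _ hbr h1]

theorem diag_apply_eq_zero (H : SeparateStates q η A D R L κ κ' ψ) (hg : Generic q η)
    {h : Spins N} {a : Fin N} (ha : h a = 0) : D (η a) *ᵥ ψ h = 0 := by
  rw [H.diag_apply hg h (hg.η_ne a), ← node_zero (q := q) (η := η) a, ← ha, dEigen_node hg,
    zero_smul]

theorem raise_apply_zero (H : SeparateStates q η A D R L κ κ' ψ) {h : Spins N} {a : Fin N}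
    (ha : h a = 0) : R (η a) *ᵥ ψ h = κ a • ψ (Function.update h a 1) := by
  rw [H.raise h a ha, smul_inv_smul₀ (H.κ_ne a)]

theorem eq_update_update {h : Spins N} {a : Fin N} (ha : h a = 1) :
    h = Function.update (Function.update h a 0) a 1 := by
  rw [Function.update_idem, ← ha, Function.update_eq_self]

theorem raise_apply_one (H : SeparateStates q η A D R L κ κ' ψ) {h : Spins N} {a : Fin N}
    (ha : h a = 1) : R (η a / q) *ᵥ ψ h = 0 := by
  rw [eq_update_update ha, H.raise _ a (by simp), Matrix.mulVec_smul, ← Op.mul_mulVec,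
    H.raise_raise, Matrix.zero_mulVec, smul_zero]

/-- The quantum determinant inverts the raising operator at `η_a`, since `D(η_a)` annihilates the
states with `h_a = 0`. -/
theorem lower_apply_one (H : SeparateStates q η A D R L κ κ' ψ) (hg : Generic q η)
    {h : Spins N} {a : Fin N} (ha : h a = 1) :
    L (η a / q) *ᵥ ψ h = κ' a • ψ (Function.update h a 0) := by
  have h1 := congrArg (· *ᵥ ψ (Function.update h a 0)) (H.qdet a)
  simp only [Matrix.sub_mulVec, Op.mul_mulVec, Matrix.neg_mulVec, Matrix.smul_mulVec,
    Matrix.one_mulVec,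
    H.diag_apply_eq_zero hg (h := Function.update h a 0) (a := a) (by simp), Matrix.mulVec_zero,
    zero_sub, neg_inj] at h1
  conv_lhs => rw [eq_update_update ha, H.raise _ a (by simp), Matrix.mulVec_smul, h1, smul_smul,
    inv_mul_cancel_left₀ (H.κ_ne a)]

/-- The lowering operator at `η_a` passes through the raising operators at the other `η_b`, since
`D` annihilates the states in between. -/
theorem lower_apply_zero (H : SeparateStates q η A D R L κ κ' ψ) (hg : Generic q η)
    (h : Spins N) {a : Fin N} (ha : h a = 0) : L (η a) *ᵥ ψ h = 0 := by
  induction h using spins_induction with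
  | h0 => exact H.lower_ref _
  | hs h b hb ih =>
    have hab : a ≠ b := by
      rintro rfl
      simp at ha
    rw [Function.update_of_ne hab] at ha
    have hbr : br (η a / η b) ≠ 0 := by
      have := hg.node_ne a b 0 0 (by simpa using hab)
      rw [node_zero, node_zero] at this
      exact br_div_ne_zero (hg.η_ne a) (hg.η_ne b) this
    have h1 := congrArg (· *ᵥ ψ h) (H.lower_raise (η a) (η b) (hg.η_ne a) (hg.η_ne b))
    simp only [Matrix.smul_mulVec, Matrix.sub_mulVec, Op.mul_mulVec,
      H.diag_apply_eq_zero hg ha, H.diag_apply_eq_zero hg hb, Matrix.mulVec_zero, ih ha, sub_zero,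
      smul_zero] at h1
    rw [H.raise h b hb, Matrix.mulVec_smul, (smul_eq_zero.mp h1).resolve_left hbr, smul_zero]

/-- Lagrange interpolation at the zeros of `d_h` for an operator with odd Laurent entries. -/
theorem mulVec_eq_sum_interp (hg : Generic q η) {X : ℂ → Op N}
    (hX : ∀ s t, OddLaurent N fun lam => X lam s t) (h : Spins N) (v : Spins N → ℂ) {lam : ℂ}
    (hl : lam ≠ 0) :
    X lam *ᵥ v = ∑ a, interp q η h a lam • (X (node q η a (h a)) *ᵥ v) := by
  funext s
  rw [Finset.sum_apply]
  have h1 : OddLaurent N fun lam => (X lam *ᵥ v) s := by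
    refine OddLaurent.sum _ fun t _ => ?_
    simpa only [mul_comm] using (hX s t).const_mul (v t)
  have h2 : OddLaurent N fun lam =>
      ∑ a, (interp q η h a lam • (X (node q η a (h a)) *ᵥ v)) s := by
    refine OddLaurent.sum _ fun a _ => ?_
    simpa only [Pi.smul_apply, smul_eq_mul, mul_comm] using
      (interp_oddLaurent hg h a).const_mul ((X (node q η a (h a)) *ᵥ v) s)
  refine h1.eq_of_eq_on_nodes h2 (fun a => hg.node_ne_zero a (h a))
    (fun a b hab => hg.node_ne _ _ _ _ fun e => hab (congrArg Prod.fst e)) (fun a => ?_) hl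
  rw [Finset.sum_eq_single a]
  · rw [interp_self hg, one_smul]
  · intro b _ hb
    rw [interp_of_ne hg h hb, zero_smul, Pi.zero_apply]
  · simp

/-- At the zeros of `d_h` the raising operator either raises one entry or vanishes, so
interpolation gives its action everywhere. -/
theorem raise_apply (H : SeparateStates q η A D R L κ κ' ψ) (hg : Generic q η) (h : Spins N)
    {lam : ℂ} (hl : lam ≠ 0) :
    R lam *ᵥ ψ h = ∑ a, (interp q η h a lam * κ a) • shiftUp ψ a h := by
  rw [mulVec_eq_sum_interp hg H.raise_laurent h (ψ h) hl]
  refine Finset.sum_congr rfl fun a _ => ?_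
  rw [shiftUp]
  rcases Fin.exists_fin_two.mp ⟨h a, rfl⟩ with ha | ha
  · rw [ha, node_zero, H.raise_apply_zero ha, if_pos rfl, smul_smul]
  · rw [ha, node_one, H.raise_apply_one ha, if_neg one_ne_zero, smul_zero, smul_zero]

theorem lower_apply (H : SeparateStates q η A D R L κ κ' ψ) (hg : Generic q η) (h : Spins N)
    {lam : ℂ} (hl : lam ≠ 0) :
    L lam *ᵥ ψ h = ∑ a, (interp q η h a lam * κ' a) • shiftDown ψ a h := by
  rw [mulVec_eq_sum_interp hg H.lower_laurent h (ψ h) hl]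
  refine Finset.sum_congr rfl fun a _ => ?_
  rw [shiftDown]
  rcases Fin.exists_fin_two.mp ⟨h a, rfl⟩ with ha | ha
  · rw [ha, node_zero, H.lower_apply_zero hg h ha, if_neg zero_ne_one, smul_zero, smul_zero]
  · rw [ha, node_one, H.lower_apply_one hg ha, if_pos rfl, smul_smul]

theorem ne_zero (H : SeparateStates q η A D R L κ κ' ψ) (hg : Generic q η) (h : Spins N) :
    ψ h ≠ 0 := by
  induction h using spins_induction with
  | h0 => exact H.ref_ne
  | hs h a ha ih =>
    intro h0
    have h1 := H.lower_apply_one hg (h := Function.update h a 1) (a := a) (by simp)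
    rw [h0, Matrix.mulVec_zero, Function.update_idem, ← ha, Function.update_eq_self] at h1
    exact smul_ne_zero (H.κ'_ne a) ih h1.symm

theorem prod_diag_apply (H : SeparateStates q η A D R L κ κ' ψ) (hg : Generic q η)
    (h : Spins N) (l : List ℂ) (hl : ∀ x ∈ l, x ≠ 0) :
    (l.map D).prod *ᵥ ψ h = (l.map (dEigen q η h)).prod • ψ h := by
  induction l with
  | nil => simp
  | cons x l ih =>
    rw [List.map_cons, List.prod_cons, List.map_cons, List.prod_cons, Op.mul_mulVec,
      ih fun y hy => hl y (by simp [hy]), Matrix.mulVec_smul, H.diag_apply hg h (hl x (by simp)),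
      smul_smul, mul_comm]

theorem linearIndependent (H : SeparateStates q η A D R L κ κ' ψ) (hg : Generic q η) :
    LinearIndependent ℂ ψ := by
  rw [Fintype.linearIndependent_iff]
  intro c hc k
  -- the product of the values of `D` at the zeros that `d_k` lacks annihilates every other state
  set l : List ℂ := (List.finRange N).map fun a => node q η a (1 - k a) with hldef
  have hl : ∀ x ∈ l, x ≠ 0 := by
    intro x hx
    obtain ⟨a, -, rfl⟩ := List.mem_map.mp hx
    exact hg.node_ne_zero a _
  have h1 := congrArg ((l.map D).prod *ᵥ ·) hc
  simp only [Matrix.mulVec_sum, Matrix.mulVec_smul, Matrix.mulVec_zero,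
    H.prod_diag_apply hg _ l hl] at h1
  rw [Finset.sum_eq_single k] at h1
  · have h2 : (l.map (dEigen q η k)).prod ≠ 0 := by
      refine List.prod_ne_zero fun h0 => ?_
      obtain ⟨x, hx, hx0⟩ := List.mem_map.mp h0
      refine dEigen_ne_zero hg (hl x hx) (fun b => ?_) hx0
      obtain ⟨a, -, rfl⟩ := List.mem_map.mp hx
      refine hg.node_ne _ _ _ _ fun e => ?_
      obtain ⟨rfl, e⟩ := Prod.mk.inj e
      rcases Fin.exists_fin_two.mp ⟨k a, rfl⟩ with h | h <;> simp [h] at e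
    exact (smul_eq_zero.mp h1).resolve_right (smul_ne_zero h2 (H.ne_zero hg k))
  · intro h _ hne
    obtain ⟨a, ha⟩ := Function.ne_iff.mp hne
    have h2 : (l.map (dEigen q η h)).prod = 0 := by
      refine List.prod_eq_zero (List.mem_map.mpr ⟨node q η a (1 - k a), ?_, ?_⟩)
      · exact List.mem_map.mpr ⟨a, List.mem_finRange a, rfl⟩
      · have : 1 - k a = h a := by
          rcases Fin.exists_fin_two.mp ⟨k a, rfl⟩ with e | e <;>
            rcases Fin.exists_fin_two.mp ⟨h a, rfl⟩ with e' | e' <;> simp_all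
        rw [this, dEigen_node hg]
    rw [h2, zero_smul, smul_zero]
  · simp

theorem exists_basis (H : SeparateStates q η A D R L κ κ' ψ) (hg : Generic q η) :
    ∃ β : Module.Basis (Spins N) ℂ (Spins N → ℂ), ∀ h, β h = ψ h :=
  ⟨basisOfLinearIndependentOfCardEqFinrank (H.linearIndependent hg) (by simp),
    fun h => by simp⟩

/-- `D(lam)` can be cancelled on the right when none of its eigenvalues vanishes. -/
theorem eq_of_mul_diag_eq (H : SeparateStates q η A D R L κ κ' ψ) (hg : Generic q η)
    {X Y : Op N} {lam : ℂ} (hl : lam ≠ 0) (hd : ∀ h, dEigen q η h lam ≠ 0)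
    (hXY : X * D lam = Y * D lam) : X = Y := by
  obtain ⟨β, hβ⟩ := H.exists_basis hg
  refine Matrix.toLin'.injective (β.ext fun h => ?_)
  have h1 := congrArg (· *ᵥ ψ h) hXY
  simp only [Op.mul_mulVec, H.diag_apply hg h hl, Matrix.mulVec_smul] at h1
  simpa only [Matrix.toLin'_apply, hβ] using smul_right_injective _ (hd h) h1

end SeparateStates

end Separation

end XXZ
namespace XXZ

/-! ### Relations of the Yang-Baxter algebra -/

section Relations

variable {S : Type*} [Ring S] [Algebra ℂ S] {q u δ : ℂ} {T T' : Matrix (Fin 2) (Fin 2) S}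

theorem mul_algebraMap_eq_smul (c : ℂ) (x : S) : x * algebraMap ℂ S c = c • x := by
  rw [← Algebra.commutes, ← Algebra.smul_def]

theorem RTT.same (h : RTT q u T T') (i j : Fin 2) :
    br (u * q) • (T i j * T' i j) = br (u * q) • (T' i j * T i j) := by
  have := congrFun (congrFun h (i, i)) (j, j)
  fin_cases i <;> fin_cases j <;>
    simpa [Matrix.mul_apply, Fintype.sum_prod_type, Fin.sum_univ_two, tens, tensRev, scal, rMat,
      mul_algebraMap_eq_smul, ← Algebra.smul_def] using this

theorem RTT.diag_lower (h : RTT q u T T') :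
    br (u * q) • (T 1 1 * T' 1 0) = br u • (T' 1 0 * T 1 1) + br q • (T' 1 1 * T 1 0) := by
  have := congrFun (congrFun h (1, 1)) (1, 0)
  simp [Matrix.mul_apply, Fintype.sum_prod_type, Fin.sum_univ_two, tens, tensRev, scal, rMat,
      mul_algebraMap_eq_smul, ← Algebra.smul_def] at this
  rw [this, add_comm]

theorem RTT.diag_upper (h : RTT q u T T') :
    br u • (T 1 1 * T' 0 1) + br q • (T 0 1 * T' 1 1) = br (u * q) • (T' 0 1 * T 1 1) := by
  have := congrFun (congrFun h (1, 0)) (1, 1)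
  simp [Matrix.mul_apply, Fintype.sum_prod_type, Fin.sum_univ_two, tens, tensRev, scal, rMat,
      mul_algebraMap_eq_smul, ← Algebra.smul_def] at this
  rw [← this, add_comm]

theorem RTT.upper_lower (h : RTT q u T T') :
    br u • (T' 1 0 * T 0 1 - T 0 1 * T' 1 0) = br q • (T 1 1 * T' 0 0 - T' 1 1 * T 0 0) := by
  have := congrFun (congrFun h (0, 1)) (1, 0)
  simp [Matrix.mul_apply, Fintype.sum_prod_type, Fin.sum_univ_two, tens, tensRev, scal, rMat,
      mul_algebraMap_eq_smul, ← Algebra.smul_def] at this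
  rw [smul_sub, smul_sub, sub_eq_sub_iff_add_eq_add]
  rw [add_comm, ← this, add_comm]

theorem RTT.lower_upper (h : RTT q u T T') :
    br u • (T 1 0 * T' 0 1 - T' 0 1 * T 1 0) = br q • (T' 0 0 * T 1 1 - T 0 0 * T' 1 1) := by
  have := congrFun (congrFun h (1, 0)) (0, 1)
  simp [Matrix.mul_apply, Fintype.sum_prod_type, Fin.sum_univ_two, tens, tensRev, scal, rMat,
      mul_algebraMap_eq_smul, ← Algebra.smul_def] at this
  rw [smul_sub, smul_sub, sub_eq_sub_iff_add_eq_add]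
  rw [add_comm, this, add_comm]

theorem QDet.eq₁ (h : QDet δ T T') : T' 0 0 * T 1 1 - T' 0 1 * T 1 0 = δ • (1 : S) := by
  have := congrFun (congrFun h.1 (1, 0)) (1, 0)
  simpa [Matrix.mul_apply, Fintype.sum_prod_type, Fin.sum_univ_two, tensRev, scal, antiMat,
    sub_eq_add_neg, add_comm] using this

theorem QDet.eq₂ (h : QDet δ T T') : T' 1 1 * T 0 0 - T' 1 0 * T 0 1 = δ • (1 : S) := by
  have := congrFun (congrFun h.1 (0, 1)) (0, 1)
  simpa [Matrix.mul_apply, Fintype.sum_prod_type, Fin.sum_univ_two, tensRev, scal, antiMat,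
    sub_eq_add_neg, add_comm] using this

theorem QDet.eq₃ (h : QDet δ T T') : T 0 0 * T' 1 1 - T 1 0 * T' 0 1 = δ • (1 : S) := by
  have := congrFun (congrFun h.2 (0, 1)) (0, 1)
  simpa [Matrix.mul_apply, Fintype.sum_prod_type, Fin.sum_univ_two, tens, scal, antiMat,
    sub_eq_add_neg, add_comm] using this

end Relations

/-! ### Left and right separate states -/

section Main

variable {N : ℕ} {q : ℂ} {η : Fin N → ℂ}

theorem monodromy_RTT (hq : q ≠ 0) (hη : ∀ n, η n ≠ 0) {lam mu : ℂ} (hl : lam ≠ 0)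
    (hm : mu ≠ 0) : RTT q (lam / mu) (monodromy q η lam) (monodromy q η mu) := by
  rw [monodromy_eq, monodromy_eq]
  exact mono_RTT hq hη hl hm (nodup_sites N)

theorem prod_sites (f : Fin N → ℂ) : ((List.finRange N).reverse.map f).prod = ∏ n, f n := by
  rw [((List.reverse_perm _).map f).prod_eq, Fin.prod_univ_def]

theorem monodromy_QDet (hq : q ≠ 0) (hη : ∀ n, η n ≠ 0) {lam : ℂ} (hl : lam ≠ 0) :
    QDet (-(aFun q η lam * dFun η (lam / q))) (monodromy q η (lam / q)) (monodromy q η lam) := by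
  have h := mono_QDet hq hη hl (nodup_sites N)
  rw [← monodromy_eq, ← monodromy_eq, prod_sites] at h
  convert h using 1
  rw [aFun, dFun, neg_mul, neg_neg, ← Finset.prod_mul_distrib]
  refine Finset.prod_congr rfl fun n _ => ?_
  rw [← br_div, ← br_div, mul_div_right_comm, div_right_comm]

theorem monodromy_entryLaurent (hq : q ≠ 0) (hη : ∀ n, η n ≠ 0) (i j : Fin 2) (s t : Spins N) :
    EntryLaurent i j N fun lam => monodromy q η lam i j s t := by
  have := mono_entryLaurent hq hη (List.finRange N).reverse i j s t
  simpa only [← monodromy_eq, List.length_reverse, List.length_finRange] using this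

theorem EntryLaurent.continuousOn {i j : Fin 2} {n : ℕ} {f : ℂ → ℂ} (h : EntryLaurent i j n f) :
    ContinuousOn f {0}ᶜ := by
  unfold EntryLaurent at h
  split_ifs at h
  · exact EvenLaurent.continuousOn h
  · exact OddLaurent.continuousOn h

theorem monodromy_continuousOn (hq : q ≠ 0) (hη : ∀ n, η n ≠ 0) (i j : Fin 2) :
    ContinuousOn (fun lam => monodromy q η lam i j) {0}ᶜ :=
  continuousOn_pi.mpr fun s => continuousOn_pi.mpr fun t =>
    (monodromy_entryLaurent hq hη i j s t).continuousOn

/-- The `RTT` relation gives this wherever `br (lam q / mu) ≠ 0`, and continuity in `lam` gives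
the rest. -/
theorem monodromy_commute (hq : q ≠ 0) (hη : ∀ n, η n ≠ 0) (i j : Fin 2) {lam mu : ℂ}
    (hl : lam ≠ 0) (hm : mu ≠ 0) : Commute (monodromy q η lam i j) (monodromy q η mu i j) := by
  have hc := monodromy_continuousOn hq hη i j
  refine eq_of_eq_off_finite (f := fun lam => monodromy q η lam i j * monodromy q η mu i j)
    (g := fun lam => monodromy q η mu i j * monodromy q η lam i j)
    (hc.mul continuousOn_const) (continuousOn_const.mul hc)
    (finite_sq_eq (mu / q)) (fun x hx hne => ?_) hl
  refine smul_right_injective _ ?_ ((monodromy_RTT hq hη hx hm).same i j)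
  rw [div_mul_eq_mul_div, ← div_div_eq_mul_div]
  exact br_div_ne_zero hx (div_ne_zero hm hq) hne

theorem dFun_eq (lam : ℂ) : dFun η lam = ∏ n, br (lam / η n) := by
  simp only [dFun, br_div]

theorem generic_of_ne (hq0 : q ≠ 0) (hq : q ^ 2 ≠ 1) (hη0 : ∀ n, η n ≠ 0)
    (hη : ∀ a b : Fin N, a < b → ∀ j : ℤ, j ∈ ({-1, 0, 1} : Set ℤ) →
      η a ^ 2 ≠ (q ^ j * η b) ^ 2) : Generic q η := by
  refine ⟨hq0, hη0, fun a b i j hne h => ?_⟩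
  have key : ∀ (a b : Fin N) (i j : Fin 2), node q η a i ^ 2 = node q η b j ^ 2 →
      η a ^ 2 = (q ^ (((i : ℕ) : ℤ) - ((j : ℕ) : ℤ)) * η b) ^ 2 := by
    intro a b i j h
    have h1 : η a = node q η a i * q ^ (i : ℕ) :=
      (div_mul_cancel₀ _ (pow_ne_zero _ hq0)).symm
    have h2 : q ^ (((i : ℕ) : ℤ) - ((j : ℕ) : ℤ)) * η b = node q η b j * q ^ (i : ℕ) := by
      rw [zpow_sub₀ hq0, zpow_natCast, zpow_natCast, node]
      ring
    rw [h1, h2, mul_pow, mul_pow, h]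
  have hmem : ∀ i j : Fin 2, ((i : ℕ) : ℤ) - ((j : ℕ) : ℤ) ∈ ({-1, 0, 1} : Set ℤ) := by
    intro i j
    fin_cases i <;> fin_cases j <;> simp
  rcases lt_trichotomy a b with hab | rfl | hab
  · exact hη a b hab _ (hmem i j) (key a b i j h)
  · have hs : η a ^ 2 ≠ 0 := pow_ne_zero _ (hη0 a)
    have h1 : ∀ i j : Fin 2, i = 0 → j = 1 → node q η a i ^ 2 ≠ node q η a j ^ 2 := by
      rintro _ _ rfl rfl h
      rw [node_zero, node_one, div_pow, eq_div_iff (pow_ne_zero _ hq0)] at h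
      exact hq (mul_left_cancel₀ hs (h.trans (mul_one _).symm))
    rcases Fin.exists_fin_two.mp ⟨i, rfl⟩ with hi | hi <;>
      rcases Fin.exists_fin_two.mp ⟨j, rfl⟩ with hj | hj
    · exact hne (by rw [hi, hj])
    · exact h1 i j hi hj h
    · exact h1 j i hj hi h.symm
    · exact hne (by rw [hi, hj])
  · exact hη b a hab _ (hmem j i) (key b a j i h.symm)

theorem dFun_ne_zero (hg : Generic q η) (a : Fin N) :
    dFun η (η a / q) ≠ 0 := by
  rw [dFun_eq]
  refine Finset.prod_ne_zero_iff.mpr fun n _ => ?_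
  rw [← node_one, ← node_zero (q := q) (η := η) n]
  exact br_div_ne_zero (hg.node_ne_zero _ _) (hg.node_ne_zero _ _)
    (hg.node_ne _ _ _ _ (by simp))

theorem aFun_ne_zero (hg : Generic q η) (a : Fin N) : aFun q η (η a) ≠ 0 := by
  refine neg_ne_zero.mpr (Finset.prod_ne_zero_iff.mpr fun n _ => ?_)
  rw [← br_div, ← div_div_eq_mul_div, ← node_one (q := q) (η := η) n,
    ← node_zero (q := q) (η := η) a]
  exact br_div_ne_zero (hg.node_ne_zero _ _) (hg.node_ne_zero _ _)
    (hg.node_ne _ _ _ _ (by simp))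

theorem dFun_self (hη : ∀ n, η n ≠ 0) (a : Fin N) : dFun η (η a) = 0 :=
  Finset.prod_eq_zero (Finset.mem_univ a) (by simp [div_self (hη a)])

theorem aFun_self (hq : q ≠ 0) (a : Fin N) : aFun q η (η a / q) = 0 := by
  rw [aFun, neg_eq_zero]
  exact Finset.prod_eq_zero (Finset.mem_univ a) (by rw [div_mul_cancel₀ _ hq, sub_self])

theorem normFactor_ne_zero (hg : Generic q η) {r : Fin N → Fin N → ℂ}
    (hr : ∀ a b : Fin N, b < a → r a b ^ 2 = η a / η b - η b / η a) : normFactor r ≠ 0 := by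
  refine Finset.prod_ne_zero_iff.mpr fun a _ => Finset.prod_ne_zero_iff.mpr fun b hb h0 => ?_
  have hba : b < a := by simpa using hb
  have h1 := hr a b hba
  rw [h0, ← br_div, zero_pow two_ne_zero] at h1
  have h2 := hg.node_ne a b 0 0 (by simpa using hba.ne')
  rw [node_zero, node_zero] at h2
  exact br_div_ne_zero (hg.η_ne a) (hg.η_ne b) h2 h1.symm

/-- Raising one exponent from `0` to `1` in a product of commuting factors. -/
theorem list_prod_pow_update {M : Type*} [Monoid M] (G : Fin N → M)
    (hG : ∀ a b, Commute (G a) (G b)) {h : Spins N} {a : Fin N} (ha : h a = 0)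
    {l : List (Fin N)} (hl : l.Nodup) (hal : a ∈ l) :
    (l.map fun n => G n ^ (Function.update h a 1 n : ℕ)).prod =
      G a * (l.map fun n => G n ^ (h n : ℕ)).prod := by
  induction l with
  | nil => simp at hal
  | cons b l ih =>
    rw [List.nodup_cons] at hl
    rw [List.map_cons, List.prod_cons, List.map_cons, List.prod_cons]
    by_cases hab : a = b
    · subst hab
      have : (l.map fun n => G n ^ (Function.update h a 1 n : ℕ)) =
          l.map fun n => G n ^ (h n : ℕ) := by
        refine List.map_congr_left fun n hn => ?_
        rw [Function.update_of_ne]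
        rintro rfl
        exact hl.1 hn
      rw [this, Function.update_self, ha]
      simp
    · rw [ih hl.2 ((List.mem_cons.mp hal).resolve_left hab), Function.update_of_ne (Ne.symm hab),
        ← mul_assoc, ← mul_assoc, ((hG a b).pow_right _).eq]

theorem refState_ne_zero (N : ℕ) : refState N ≠ 0 := by
  intro h
  simpa [refState] using congrFun h fun _ => 0

theorem leftState_zero (r : Fin N → Fin N → ℂ) :
    leftState q η r (fun _ => 0) = (normFactor r)⁻¹ • refState N := by
  simp [leftState]

theorem rightState_zero (r : Fin N → Fin N → ℂ) :
    rightState q η r (fun _ => 0) = (normFactor r)⁻¹ • refState N := by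
  simp [rightState]

theorem leftState_update (hq : q ≠ 0) (hη : ∀ n, η n ≠ 0) (r : Fin N → Fin N → ℂ) {h : Spins N}
    {a : Fin N} (ha : h a = 0) : leftState q η r (Function.update h a 1) =
      (dFun η (η a / q))⁻¹ • ((opC q η (η a))ᵀ *ᵥ leftState q η r h) := by
  set G : Fin N → Op N := fun n => (dFun η (η n / q))⁻¹ • opC q η (η n)
  have hG : ∀ a b, Commute (G a) (G b) := fun a b =>
    ((monodromy_commute hq hη 1 0 (hη a) (hη b)).smul_left _).smul_right _
  have hc : Commute (G a) (List.ofFn fun n => G n ^ (h n : ℕ)).prod := by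
    refine Commute.list_prod_right _ _ fun x hx => ?_
    obtain ⟨n, rfl⟩ := List.mem_ofFn.mp hx
    exact (hG a n).pow_right _
  have h1 : (List.ofFn fun n => G n ^ (Function.update h a 1 n : ℕ)).prod =
      (List.ofFn fun n => G n ^ (h n : ℕ)).prod * G a := by
    rw [← hc.eq, List.ofFn_eq_map, List.ofFn_eq_map,
      list_prod_pow_update G hG ha (List.nodup_finRange N) (List.mem_finRange a)]
  rw [leftState, leftState, h1, Op.vecMul_mul, Matrix.mulVec_transpose, Matrix.vecMul_smul,
    Matrix.smul_vecMul, smul_comm]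

theorem rightState_update (hq : q ≠ 0) (hη : ∀ n, η n ≠ 0) (r : Fin N → Fin N → ℂ)
    {h : Spins N} {a : Fin N} (ha : h a = 0) : rightState q η r (Function.update h a 1) =
      (aFun q η (η a))⁻¹ • (opB q η (η a) *ᵥ rightState q η r h) := by
  set G : Fin N → Op N := fun n => (aFun q η (η n))⁻¹ • opB q η (η n)
  have hG : ∀ a b, Commute (G a) (G b) := fun a b =>
    ((monodromy_commute hq hη 0 1 (hη a) (hη b)).smul_left _).smul_right _
  have h1 : (List.ofFn fun n => G n ^ (Function.update h a 1 n : ℕ)).prod =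
      G a * (List.ofFn fun n => G n ^ (h n : ℕ)).prod := by
    rw [List.ofFn_eq_map, List.ofFn_eq_map,
      list_prod_pow_update G hG ha (List.nodup_finRange N) (List.mem_finRange a)]
  rw [rightState, rightState, h1, Op.mul_mulVec, Matrix.smul_mulVec, Matrix.mulVec_smul,
    smul_comm]

theorem monodromy_mulVec_refState (lam : ℂ) :
    opC q η lam *ᵥ refState N = 0 ∧ opD q η lam *ᵥ refState N = dFun η lam • refState N := by
  rw [opC, opD, monodromy_eq, dFun_eq, ← prod_sites]
  exact (mono_mulVec_refState (nodup_sites N) lam).2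

theorem refState_vecMul_monodromy (lam : ℂ) :
    refState N ᵥ* opB q η lam = 0 ∧ refState N ᵥ* opD q η lam = dFun η lam • refState N := by
  rw [opB, opD, monodromy_eq, dFun_eq, ← prod_sites]
  exact (refState_vecMul_mono (nodup_sites N) lam).2

theorem monodromy_mul_eq_zero (hq : q ≠ 0) (hη : ∀ n, η n ≠ 0) (a : Fin N) (i j k : Fin 2) :
    monodromy q η (η a) i j * monodromy q η (η a / q) i k = 0 := by
  rw [monodromy_eq, monodromy_eq]
  exact mono_mul_eq_zero hq hη (nodup_sites N) (by simp) i j k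

/-- Transposition turns the action on covectors into one on vectors; it exchanges the roles of
`B` and `C`. -/
theorem left_separateStates (hg : Generic q η) {r : Fin N → Fin N → ℂ}
    (hr : normFactor r ≠ 0) :
    SeparateStates q η (fun lam => (opA q η lam)ᵀ) (fun lam => (opD q η lam)ᵀ)
      (fun lam => (opC q η lam)ᵀ) (fun lam => (opB q η lam)ᵀ)
      (fun a => dFun η (η a / q)) (fun a => aFun q η (η a)) (leftState q η r) where
  diag_raise lam mu hl hm := by
    simp only [← Matrix.transpose_mul, ← Matrix.transpose_smul, ← Matrix.transpose_sub]
    congr 1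
    rw [eq_sub_iff_add_eq]
    exact (monodromy_RTT hg.q_ne hg.η_ne hl hm).diag_lower.symm
  lower_raise lam mu hl hm := by
    simp only [← Matrix.transpose_mul, ← Matrix.transpose_smul, ← Matrix.transpose_sub]
    congr 1
    exact (monodromy_RTT hg.q_ne hg.η_ne hl hm).upper_lower
  qdet a := by
    rw [← Matrix.transpose_mul, ← Matrix.transpose_mul, ← Matrix.transpose_sub, ← neg_smul,
      mul_comm]
    have := congrArg Matrix.transpose (monodromy_QDet hg.q_ne hg.η_ne (hg.η_ne a)).eq₂
    rwa [Matrix.transpose_smul, Matrix.transpose_one] at this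
  raise_raise a := by
    rw [← Matrix.transpose_mul, opC, opC, monodromy_mul_eq_zero hg.q_ne hg.η_ne,
      Matrix.transpose_zero]
  diag_laurent s t := by
    simpa [EntryLaurent, opB, opC, opD] using
      monodromy_entryLaurent hg.q_ne hg.η_ne 1 1 t s
  raise_laurent s t := by
    simpa [EntryLaurent, opB, opC, opD] using
      monodromy_entryLaurent hg.q_ne hg.η_ne 1 0 t s
  lower_laurent s t := by
    simpa [EntryLaurent, opB, opC, opD] using
      monodromy_entryLaurent hg.q_ne hg.η_ne 0 1 t s
  diag_ref lam := by
    rw [leftState_zero, Matrix.mulVec_transpose, Matrix.smul_vecMul,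
      (refState_vecMul_monodromy lam).2, smul_comm]
  lower_ref lam := by
    rw [leftState_zero, Matrix.mulVec_transpose, Matrix.smul_vecMul,
      (refState_vecMul_monodromy lam).1, smul_zero]
  ref_ne := by
    rw [leftState_zero]
    exact smul_ne_zero (inv_ne_zero hr) (refState_ne_zero N)
  κ_ne := dFun_ne_zero hg
  κ'_ne := aFun_ne_zero hg
  raise _ _ ha := leftState_update hg.q_ne hg.η_ne r ha

theorem right_separateStates (hg : Generic q η) {r : Fin N → Fin N → ℂ}
    (hr : normFactor r ≠ 0) :
    SeparateStates q η (opA q η) (opD q η) (opB q η) (opC q η)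
      (fun a => aFun q η (η a)) (fun a => dFun η (η a / q)) (rightState q η r) where
  diag_raise lam mu hl hm := by
    rw [eq_sub_iff_add_eq]
    exact (monodromy_RTT hg.q_ne hg.η_ne hl hm).diag_upper
  lower_raise lam mu hl hm := (monodromy_RTT hg.q_ne hg.η_ne hl hm).lower_upper
  qdet a := by
    rw [← neg_smul]
    exact (monodromy_QDet hg.q_ne hg.η_ne (hg.η_ne a)).eq₃
  raise_raise a := by
    rw [← (monodromy_mul_eq_zero hg.q_ne hg.η_ne a 0 1 1)]
    exact monodromy_commute hg.q_ne hg.η_ne 0 1 (div_ne_zero (hg.η_ne a) hg.q_ne) (hg.η_ne a)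
  diag_laurent s t := by
    simpa [EntryLaurent, opB, opC, opD] using
      monodromy_entryLaurent hg.q_ne hg.η_ne 1 1 s t
  raise_laurent s t := by
    simpa [EntryLaurent, opB, opC, opD] using
      monodromy_entryLaurent hg.q_ne hg.η_ne 0 1 s t
  lower_laurent s t := by
    simpa [EntryLaurent, opB, opC, opD] using
      monodromy_entryLaurent hg.q_ne hg.η_ne 1 0 s t
  diag_ref lam := by
    rw [rightState_zero, Matrix.mulVec_smul, (monodromy_mulVec_refState lam).2, smul_comm]
  lower_ref lam := by
    rw [rightState_zero, Matrix.mulVec_smul, (monodromy_mulVec_refState lam).1, smul_zero]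
  ref_ne := by
    rw [rightState_zero]
    exact smul_ne_zero (inv_ne_zero hr) (refState_ne_zero N)
  κ_ne := aFun_ne_zero hg
  κ'_ne := dFun_ne_zero hg
  raise _ _ ha := rightState_update hg.q_ne hg.η_ne r ha

theorem sum_shiftUp_congr (c d e : Fin N → ℂ) (ψ : Spins N → Spins N → ℂ) (h : Spins N)
    (hde : ∀ a, h a = 0 → d a = e a) :
    ∑ a, (c a * d a) • shiftUp ψ a h = ∑ a, (c a * e a) • shiftUp ψ a h := by
  refine Finset.sum_congr rfl fun a _ => ?_
  rw [shiftUp]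
  split_ifs with ha
  · rw [hde a ha]
  · rw [smul_zero, smul_zero]

theorem sum_shiftDown_congr (c d e : Fin N → ℂ) (ψ : Spins N → Spins N → ℂ) (h : Spins N)
    (hde : ∀ a, h a = 1 → d a = e a) :
    ∑ a, (c a * d a) • shiftDown ψ a h = ∑ a, (c a * e a) • shiftDown ψ a h := by
  refine Finset.sum_congr rfl fun a _ => ?_
  rw [shiftDown]
  split_ifs with ha
  · rw [hde a ha]
  · rw [smul_zero, smul_zero]

end Main

end XXZ
theorem mainTheorem2 (N : ℕ) (q : ℂ) (η : Fin N → ℂ) (r : Fin N → Fin N → ℂ)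
    (hq0 : q ≠ 0) (hq : q ^ 2 ≠ 1) (hη0 : ∀ n, η n ≠ 0)
    (hη : ∀ a b : Fin N, a < b → ∀ j : ℤ, j ∈ ({-1, 0, 1} : Set ℤ) →
      η a ^ 2 ≠ (q ^ j * η b) ^ 2)
    (hr : ∀ a b : Fin N, b < a → r a b ^ 2 = η a / η b - η b / η a) :
    -- the order of the factors in the two families of states is immaterial
    (∀ lam mu : ℂ, lam ≠ 0 → mu ≠ 0 →
      Commute (XXZ.opC q η lam) (XXZ.opC q η mu) ∧
      Commute (XXZ.opB q η lam) (XXZ.opB q η mu)) ∧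
    -- the out-of-range shifts come with vanishing coefficients
    (∀ a : Fin N, XXZ.dFun η (η a) = 0 ∧ XXZ.aFun q η (η a / q) = 0) ∧
    -- left eigenbasis and left representation
    ((∃ β : Module.Basis (XXZ.Spins N) ℂ (XXZ.LeftSpace N),
        ∀ h, β h = XXZ.leftState q η r h) ∧
      ∀ (h : XXZ.Spins N) (lam : ℂ), lam ≠ 0 →
        XXZ.leftState q η r h ᵥ* XXZ.opD q η lam =
          XXZ.dEigen q η h lam • XXZ.leftState q η r h ∧
        XXZ.leftState q η r h ᵥ* XXZ.opC q η lam =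
          ∑ a, (XXZ.interp q η h a lam * XXZ.dFun η (η a * q ^ (((h a : ℕ) : ℤ) - 1))) •
            XXZ.shiftUp (XXZ.leftState q η r) a h ∧
        XXZ.leftState q η r h ᵥ* XXZ.opB q η lam =
          ∑ a, (XXZ.interp q η h a lam * XXZ.aFun q η (η a * q ^ (((h a : ℕ) : ℤ) - 1))) •
            XXZ.shiftDown (XXZ.leftState q η r) a h) ∧
    -- right eigenbasis and right representation
    ((∃ β : Module.Basis (XXZ.Spins N) ℂ (XXZ.RightSpace N),
        ∀ h, β h = XXZ.rightState q η r h) ∧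
      ∀ (h : XXZ.Spins N) (lam : ℂ), lam ≠ 0 →
        XXZ.opD q η lam *ᵥ XXZ.rightState q η r h =
          XXZ.dEigen q η h lam • XXZ.rightState q η r h ∧
        XXZ.opC q η lam *ᵥ XXZ.rightState q η r h =
          ∑ a, (XXZ.interp q η h a lam * XXZ.dFun η (η a * q ^ (-((h a : ℕ) : ℤ)))) •
            XXZ.shiftDown (XXZ.rightState q η r) a h ∧
        XXZ.opB q η lam *ᵥ XXZ.rightState q η r h =
          ∑ a, (XXZ.interp q η h a lam * XXZ.aFun q η (η a * q ^ (-((h a : ℕ) : ℤ)))) •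
            XXZ.shiftUp (XXZ.rightState q η r) a h) ∧
    -- the quantum determinant relation, and `A` is its only solution: pointwise wherever
    -- no eigenvalue of `D(lam / q)` vanishes, and everywhere among continuous families
    (∀ lam : ℂ, lam ≠ 0 →
      XXZ.opA q η lam * XXZ.opD q η (lam / q) - XXZ.opB q η lam * XXZ.opC q η (lam / q) =
        (-(XXZ.aFun q η lam * XXZ.dFun η (lam / q))) • (1 : XXZ.Op N)) ∧
    (∀ (lam : ℂ) (X : XXZ.Op N), lam ≠ 0 →
      (∀ h : XXZ.Spins N, XXZ.dEigen q η h (lam / q) ≠ 0) →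
      X * XXZ.opD q η (lam / q) - XXZ.opB q η lam * XXZ.opC q η (lam / q) =
        (-(XXZ.aFun q η lam * XXZ.dFun η (lam / q))) • (1 : XXZ.Op N) →
      X = XXZ.opA q η lam) ∧
    (∀ X : ℂ → XXZ.Op N, ContinuousOn X {0}ᶜ →
      (∀ lam : ℂ, lam ≠ 0 →
        X lam * XXZ.opD q η (lam / q) - XXZ.opB q η lam * XXZ.opC q η (lam / q) =
          (-(XXZ.aFun q η lam * XXZ.dFun η (lam / q))) • (1 : XXZ.Op N)) →
      ∀ lam : ℂ, lam ≠ 0 → X lam = XXZ.opA q η lam) := by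

  have hg := XXZ.generic_of_ne hq0 hq hη0 hη
  have hn := XXZ.normFactor_ne_zero hg hr
  have HL := XXZ.left_separateStates hg hn
  have HR := XXZ.right_separateStates hg hn
  have hdet : ∀ lam : ℂ, lam ≠ 0 →
      XXZ.opA q η lam * XXZ.opD q η (lam / q) - XXZ.opB q η lam * XXZ.opC q η (lam / q) =
        (-(XXZ.aFun q η lam * XXZ.dFun η (lam / q))) • (1 : XXZ.Op N) :=
    fun lam hl => (XXZ.monodromy_QDet hq0 hη0 hl).eq₁
  have huniq : ∀ (lam : ℂ) (X : XXZ.Op N), lam ≠ 0 →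
      (∀ h : XXZ.Spins N, XXZ.dEigen q η h (lam / q) ≠ 0) →
      X * XXZ.opD q η (lam / q) - XXZ.opB q η lam * XXZ.opC q η (lam / q) =
        (-(XXZ.aFun q η lam * XXZ.dFun η (lam / q))) • (1 : XXZ.Op N) →
      X = XXZ.opA q η lam := fun lam X hl hd hX =>
    HR.eq_of_mul_diag_eq hg (div_ne_zero hl hq0) hd
      (sub_left_injective (hX.trans (hdet lam hl).symm))
  refine ⟨fun lam mu hl hm => ⟨XXZ.monodromy_commute hq0 hη0 1 0 hl hm,
    XXZ.monodromy_commute hq0 hη0 0 1 hl hm⟩,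
    fun a => ⟨XXZ.dFun_self hη0 a, XXZ.aFun_self hq0 a⟩,
    ⟨HL.exists_basis hg, fun h lam hl => ⟨?_, ?_, ?_⟩⟩,
    ⟨HR.exists_basis hg, fun h lam hl => ⟨HR.diag_apply hg h hl, ?_, ?_⟩⟩,
    hdet, huniq, fun X hX hXdet lam hl => ?_⟩
  · rw [← Matrix.mulVec_transpose]
    exact HL.diag_apply hg h hl
  · rw [← Matrix.mulVec_transpose]
    refine (HL.raise_apply hg h hl).trans (XXZ.sum_shiftUp_congr _ _ _ _ _ fun a ha => ?_)
    simp [ha, div_eq_mul_inv]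
  · rw [← Matrix.mulVec_transpose]
    refine (HL.lower_apply hg h hl).trans (XXZ.sum_shiftDown_congr _ _ _ _ _ fun a ha => ?_)
    simp [ha]
  · refine (HR.lower_apply hg h hl).trans (XXZ.sum_shiftDown_congr _ _ _ _ _ fun a ha => ?_)
    simp [ha, div_eq_mul_inv]
  · refine (HR.raise_apply hg h hl).trans (XXZ.sum_shiftUp_congr _ _ _ _ _ fun a ha => ?_)
    simp [ha]
  · -- `D(lam / q)` is invertible away from the finitely many points `±q η_a q^{-i}`
    refine XXZ.eq_of_eq_off_finite hX (XXZ.monodromy_continuousOn hq0 hη0 0 0)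
      (Set.finite_iUnion fun a => Set.finite_iUnion fun i : Fin 2 =>
        XXZ.finite_sq_eq (q * XXZ.node q η a i)) (fun x hx hne => ?_) hl
    refine huniq x (X x) hx (fun h => ?_) (hXdet x hx)
    refine XXZ.dEigen_ne_zero hg (div_ne_zero hx hq0) fun a he => hne ?_
    refine Set.mem_iUnion.mpr ⟨a, Set.mem_iUnion.mpr ⟨h a, ?_⟩⟩
    rw [Set.mem_ofPred_eq, mul_pow, ← he, div_pow, mul_div_cancel₀ _ (pow_ne_zero _ hq0)]
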